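/- **Setting.** All manifolds are connected (Hausdorff, second countable) and smooth. Let $\varepsilon,c\in\{1,-1\}$, let $N\ge 2$ and $0\le\lambda\le N$ be integers, let $I\subset\mathbb{R}$ be an open interval and $a:I\to(0,\infty)$ a smooth function. Put $\mu=\lambda$ if $c=1$ and $\mu=\lambda+1$ if $c=-1$, and let $g_0=\sum_{i=0}^{N-\mu}dx_i^2-\sum_{i=N-\mu+1}^{N}dx_i^2$ on $\mathbb{R}^{N+1}$. Let $\mathbb{M}^N_\lambda(c)$ be one connected component of the hyperquadric $\{p\in\mathbb{R}^{N+1}: g_0(p,p)=c\}$, with the metric $g$ induced by $g_0$. Let $\varepsilon I\times_a\mathbb{M}^N_\lambda(c)$ be the manifold $I\times\mathbb{M}^N_\lambda(c)$ with the semi-Riemannian metric $\langle\,,\rangle=\varepsilon\,dt^2+a(t)^2g$. Let $M^n$ be a semi-Riemannian manifold and $f:M^n\to\varepsilon I\times_a\mathbb{M}^N_\lambda(c)$ an isometric immersion; write $\langle\,,\rangle$ also for the metric of $M$. Let $\nabla$ and $\bar\nabla$ be the Levi-Civita connections of $M$ and of $\varepsilon I\times_a\mathbb{M}^N_\lambda(c)$.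 Let $R(X,Y)Z=\nabla_X\nabla_YZ-\nabla_Y\nabla_XZ-\nabla_{[X,Y]}Z$ and $R(X,Y,Z,W)=\langle R(X,Y)Z,W\rangle$. Let $\alpha(X,Y)$ be the second fundamental form of $f$, that is, the component of $\bar\nabla_X(df(Y))$ normal to $M$. Let $\pi:M\to I$ be the composition of $f$ with the projection to $I$, and let $T=\varepsilon\,\mathrm{grad}(\pi)$, the gradient being taken in $M$ (so $T$ is the tangential part of $\partial_t$). **Proposition 3.2 (Gauss equation for a given immersion).** For all smooth vector fields $X,Y,Z,W$ on $M$, $$ \begin{aligned} R(X,Y,Z,W)={}&\Big(\varepsilon\frac{(a')^2}{a^2}-\frac{c}{a^2}\Big)\Big(\langle X,Z\rangle\langle Y,W\rangle-\langle Y,Z\rangle\langle X,W\rangle\Big)\\ &+\Big(\frac{a''}{a}-\frac{(a')^2}{a^2}+\frac{\varepsilon c}{a^2}\Big)\Big(\langle X,Z\rangle\langle Y,T\rangle\langle W,T\rangle-\langle Y,Z\rangle\langle X,T\rangle\langle W,T\rangle\\ &\qquad-\langle X,W\rangle\langle Y,T\rangle\langle Z,T\rangle+\langle Y,W\rangle\langle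 X,T\rangle\langle Z,T\rangle\Big)\\ &-\langle\alpha(X,Z),\alpha(Y,W)\rangle+\langle\alpha(X,W),\alpha(Y,Z)\rangle \end{aligned} $$ at every point of $M$, where $a,a',a''$ are evaluated at $\pi$ of that point. -/

import Mathlib

open Bundle Manifold
open scoped ContDiff Topology
noncomputable section
namespace SemiRiemannian

/-- A smooth semi-Riemannian metric (of arbitrary signature) on a smooth manifold: a smooth section
of symmetric, nondegenerate bilinear forms on the tangent spaces. -/
structure Metric {E : Type*} [NormedAddCommGroup E] [NormedSpace ℝ E] {H : Type*}
    [TopologicalSpace H] (I : ModelWithCorners ℝ E H) (M : Type*) [TopologicalSpace M]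
    [ChartedSpace H M] [IsManifold I ∞ M] where
  /-- The scalar product on the tangent space at `x`. -/
  val (x : M) : TangentSpace I x →L[ℝ] TangentSpace I x →L[ℝ] ℝ
  symm (x : M) (v w : TangentSpace I x) : val x v w = val x w v
  nondegenerate (x : M) (v : TangentSpace I x) : (∀ w, val x v w = 0) → v = 0
  contMDiff : ContMDiff I (I.prod 𝓘(ℝ, E →L[ℝ] E →L[ℝ] ℝ)) ∞
    (fun x ↦ TotalSpace.mk' (E →L[ℝ] E →L[ℝ] ℝ) x (val x))

variable {E : Type*} [NormedAddCommGroup E] [NormedSpace ℝ E]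
  {H : Type*} [TopologicalSpace H] {I : ModelWithCorners ℝ E H}
  {M : Type*} [TopologicalSpace M] [ChartedSpace H M] [IsManifold I ∞ M]

/-- `D` is a Levi-Civita connection of `g`: it is torsion-free, `D_X Y - D_Y X = [X, Y]`, and
compatible with the metric, `v g(Y, Z) = g(D_v Y, Z) + g(Y, D_v Z)`. Here `D Y x v` is `D_v Y` at `x`. -/
structure IsLeviCivita (g : Metric I M) (D : CovariantDerivative I E (TangentSpace I : M → Type _)) :
    Prop where
  torsion (x : M) (X Y : Π y : M, TangentSpace I y) (hX : MDiffAt (T% X) x) (hY : MDiffAt (T% Y) x) :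
    D Y x (X x) - D X x (Y x) = VectorField.mlieBracket I X Y x
  metric (x : M) (Y Z : Π y : M, TangentSpace I y)
    (hY : MDiffAt (T% Y) x) (hZ : MDiffAt (T% Z) x) (v : TangentSpace I x) :
    mvfderiv I (fun y => g.val y (Y y) (Z y)) x v =
      g.val x (D Y x v) (Z x) + g.val x (Y x) (D Z x v)

section existence

/-- The components of a vector field in the coordinate frame centred at `x`. -/
def coord (x : M) (σ : Π y : M, TangentSpace I y) (y : M) : E :=
  (trivializationAt E (TangentSpace I) x ⟨y, σ y⟩).2

theorem coord_self (x : M) (σ : Π y : M, TangentSpace I y) : coord x σ x = σ x := by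
  have := TangentBundle.continuousLinearMapAt_trivializationAt (I := I) (mem_chart_source H x)
  rw [mfderiv_extChartAt_self] at this
  have h2 := congr($this (σ x))
  rw [Trivialization.continuousLinearMapAt_apply, Trivialization.coe_linearMapAt_of_mem _ (by simp)] at h2
  exact h2

theorem coord_mdiff {x : M} {σ : Π y : M, TangentSpace I y} (h : MDiffAt (T% σ) x) :
    MDifferentiableAt I 𝓘(ℝ, E) (coord x σ) x :=
  (mdifferentiableAt_totalSpace ..).1 h |>.2

theorem coord_add (x : M) (σ τ : Π y : M, TangentSpace I y) :
    coord x (σ + τ) =ᶠ[𝓝 x] coord x σ + coord x τ := by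
  filter_upwards [(trivializationAt E (TangentSpace I) x).open_baseSet.mem_nhds
    (FiberBundle.mem_baseSet_trivializationAt' x)] with y hy
  simp only [coord, Pi.add_apply]
  exact ((trivializationAt E (TangentSpace I) x).linear ℝ hy).map_add _ _

theorem coord_smul (x : M) (f : M → ℝ) (τ : Π y : M, TangentSpace I y) :
    coord x (f • τ) =ᶠ[𝓝 x] f • coord x τ := by
  filter_upwards [(trivializationAt E (TangentSpace I) x).open_baseSet.mem_nhds
    (FiberBundle.mem_baseSet_trivializationAt' x)] with y hy
  simp only [coord, Pi.smul_apply']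
  exact ((trivializationAt E (TangentSpace I) x).linear ℝ hy).map_smul _ _

theorem coord_bracket (x : M) (X Y : Π y : M, TangentSpace I y) (hX : MDiffAt (T% X) x)
    (hY : MDiffAt (T% Y) x) :
    mvfderiv I (coord x Y) x (X x) - mvfderiv I (coord x X) x (Y x)
      = VectorField.mlieBracket I X Y x := by
  have key : ∀ X : Π y : M, TangentSpace I y,
      VectorField.mpullbackWithin 𝓘(ℝ, E) I (extChartAt I x).symm X (Set.range I)
      =ᶠ[𝓝[Set.range I] (extChartAt I x x)] coord x X ∘ (extChartAt I x).symm := by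
    intro X
    filter_upwards [extChartAt_target_mem_nhdsWithin x] with y hy
    have hs : (extChartAt I x).symm y ∈ (chartAt H x).source := by
      rw [← extChartAt_source I]; exact (extChartAt I x).map_target hy
    have h1 := TangentBundle.continuousLinearMapAt_trivializationAt (I := I) hs
    have h2 := mfderiv_extChartAt_comp_mfderivWithin_extChartAt_symm (I := I) hy
    have h3 := mfderivWithin_extChartAt_symm_comp_mfderiv_extChartAt (I := I) hy
    simp only [VectorField.mpullbackWithin, Function.comp, coord]
    rw [ContinuousLinearMap.inverse_eq h3 h2, ← h1]
    erw [Trivialization.continuousLinearMapAt_apply]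
    rw [Trivialization.coe_linearMapAt_of_mem _ (by simpa using hs)]
  have key2 : ∀ X : Π y : M, TangentSpace I y, MDiffAt (T% X) x →
     fderivWithin ℝ (VectorField.mpullbackWithin 𝓘(ℝ, E) I (extChartAt I x).symm X (Set.range I))
       (Set.range I) (extChartAt I x x) = mvfderiv I (coord x X) x := by
    intro X hX
    rw [(key X).fderivWithin_eq ((key X).self_of_nhdsWithin (Set.mem_range_self _)), mvfderiv, (coord_mdiff hX).mfderiv]
    rfl
  have key3 : ∀ X : Π y : M, TangentSpace I y,
     (VectorField.mpullbackWithin 𝓘(ℝ, E) I (extChartAt I x).symm X (Set.range I))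
        (extChartAt I x x) = X x := by
    intro X
    rw [(key X).self_of_nhdsWithin (Set.mem_range_self _)]
    simp only [Function.comp, extChartAt_to_inv]
    exact coord_self x X
  rw [← VectorField.mlieBracketWithin_univ, VectorField.mlieBracketWithin_apply,
    mfderiv_extChartAt_self]
  simp only [VectorField.lieBracketWithin, Set.preimage_univ, Set.univ_inter, key2 X hX, key2 Y hY, key3]
  exact (congrArg (fun T : E →L[ℝ] E => T (mvfderiv I (coord x Y) x (X x) -
    mvfderiv I (coord x X) x (Y x))) (ContinuousLinearMap.inverse_id (R := ℝ) (M := E))).symm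

theorem mvfderiv_bilin {V : Type*} [NormedAddCommGroup V] [NormedSpace ℝ V] {x : M}
    {G : M → V →L[ℝ] V →L[ℝ] ℝ} {a b : M → V}
    (hG : MDifferentiableAt I 𝓘(ℝ, V →L[ℝ] V →L[ℝ] ℝ) G x) (ha : MDifferentiableAt I 𝓘(ℝ, V) a x)
    (hb : MDifferentiableAt I 𝓘(ℝ, V) b x) (v : TangentSpace I x) :
    mvfderiv I (fun y => G y (a y) (b y)) x v = mvfderiv I G x v (a x) (b x) +
      G x (mvfderiv I a x v) (b x) + G x (a x) (mvfderiv I b x v) := by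
  rw [(hG.clm_apply ha |>.clm_apply hb).mvfderiv, hG.mvfderiv, ha.mvfderiv, hb.mvfderiv]
  have hG' := hG.differentiableWithinAt_writtenInExtChartAt.hasFDerivWithinAt
  have ha' := ha.differentiableWithinAt_writtenInExtChartAt.hasFDerivWithinAt
  have hb' := hb.differentiableWithinAt_writtenInExtChartAt.hasFDerivWithinAt
  have h2 := ((hG'.clm_apply ha').clm_apply hb').fderivWithin
    (I.uniqueDiffOn _ (Set.mem_range_self _))
  refine (congrArg (fun T : E →L[ℝ] ℝ => T v) h2).trans ?_
  have e1 : writtenInExtChartAt I 𝓘(ℝ, V →L[ℝ] V →L[ℝ] ℝ) x G (extChartAt I x x) = G x := by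
    simp [writtenInExtChartAt]; rfl
  have e2 : writtenInExtChartAt I 𝓘(ℝ, V) x a (extChartAt I x x) = a x := by
    simp [writtenInExtChartAt]; rfl
  have e3 : writtenInExtChartAt I 𝓘(ℝ, V) x b (extChartAt I x x) = b x := by
    simp [writtenInExtChartAt]; rfl
  rw [e1, e2, e3]
  generalize fderivWithin ℝ (writtenInExtChartAt I 𝓘(ℝ, V →L[ℝ] V →L[ℝ] ℝ) x G) (Set.range ↑I)
    (extChartAt I x x) = P
  generalize fderivWithin ℝ (writtenInExtChartAt I 𝓘(ℝ, V) x a) (Set.range ↑I)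
    (extChartAt I x x) = Q
  generalize fderivWithin ℝ (writtenInExtChartAt I 𝓘(ℝ, V) x b) (Set.range ↑I)
    (extChartAt I x x) = R
  change G x (a x) (R v) + (G x (Q v) (b x) + P v (a x) (b x)) =
    P v (a x) (b x) + G x (Q v) (b x) + G x (a x) (R v)
  ring

theorem mvfderiv_congr {F : Type*} [NormedAddCommGroup F] [NormedSpace ℝ F] {x : M} {a b : M → F}
    (h : a =ᶠ[𝓝 x] b) : mvfderiv I a x = mvfderiv I b x := by
  ext v
  simp only [mvfderiv, h.mfderiv_eq, ContinuousLinearMap.comp_apply]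
  rfl


theorem christoffel {E : Type*} [NormedAddCommGroup E] [NormedSpace ℝ E] [FiniteDimensional ℝ E]
    (G : E →L[ℝ] E →L[ℝ] ℝ) (hG : ∀ u v, G u v = G v u) (hn : ∀ u, (∀ v, G u v = 0) → u = 0)
    (D : E →L[ℝ] E →L[ℝ] E →L[ℝ] ℝ) (hD : ∀ v u w, D v u w = D v w u) :
    ∃ Γ : E →L[ℝ] E →L[ℝ] E, (∀ u v, Γ u v = Γ v u) ∧
      ∀ u v w, D v u w = G (Γ u v) w + G u (Γ w v) := by
  have hinj : Function.Injective (G : E →ₗ[ℝ] E →L[ℝ] ℝ) := by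
    rw [← LinearMap.ker_eq_bot, LinearMap.ker_eq_bot']
    exact fun u hu => hn u fun v => congr($hu v)
  have hdim : Module.finrank ℝ E = Module.finrank ℝ (E →L[ℝ] ℝ) := by
    rw [← Subspace.dual_finrank_eq (K := ℝ) (V := E)]
    exact (LinearMap.toContinuousLinearMap (𝕜 := ℝ) (E := E) (F' := ℝ)).finrank_eq
  let S : (E →L[ℝ] ℝ) →L[ℝ] E := LinearMap.toContinuousLinearMap
    (LinearMap.linearEquivOfInjective (G : E →ₗ[ℝ] E →L[ℝ] ℝ) hinj hdim).symm.toLinearMap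
  have hS (φ : E →L[ℝ] ℝ) (w : E) : G (S φ) w = φ w :=
    congr($((LinearMap.linearEquivOfInjective
      (G : E →ₗ[ℝ] E →L[ℝ] ℝ) hinj hdim).apply_symm_apply φ) w)
  let B : E →L[ℝ] E →L[ℝ] E →L[ℝ] ℝ := (2⁻¹ : ℝ) • (D.flip + D -
    (ContinuousLinearMap.flipₗᵢ ℝ E E ℝ : (E →L[ℝ] E →L[ℝ] ℝ) →L[ℝ] (E →L[ℝ] E →L[ℝ] ℝ)) ∘L D.flip)
  have hB (u v w : E) : B u v w = 2⁻¹ * (D v u w + D u v w - D w u v) := rfl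
  have hΓ (u v w : E) : G (((ContinuousLinearMap.compL ℝ E (E →L[ℝ] ℝ) E S) ∘L B) u v) w =
      2⁻¹ * (D v u w + D u v w - D w u v) := hS (B u v) w
  refine ⟨(ContinuousLinearMap.compL ℝ E (E →L[ℝ] ℝ) E S) ∘L B, fun u v => ?_, fun u v w => ?_⟩
  · rw [← sub_eq_zero]
    refine hn _ fun w => ?_
    rw [map_sub, sub_apply, hΓ, hΓ, hD w u v]
    ring
  · rw [hG u, hΓ, hΓ, hD v w u, hD u w v, hD w v u]
    ring

/-- Every semi-Riemannian metric on a finite-dimensional manifold has a Levi-Civita connection. -/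
theorem exists_leviCivita [FiniteDimensional ℝ E] (g : Metric I M) : ∃ D, IsLeviCivita g D := by
  classical
  let tr (x : M) := trivializationAt E (TangentSpace I : M → Type _) x
  let gc (x : M) (y : M) : E →L[ℝ] E →L[ℝ] ℝ :=
    ContinuousLinearMap.inCoordinates E (TangentSpace I : M → Type _) (E →L[ℝ] ℝ)
      (fun x : M => TangentSpace I x →L[ℝ] ℝ) x y x y (g.val y)
  have hgd (x : M) : MDifferentiableAt I 𝓘(ℝ, E →L[ℝ] E →L[ℝ] ℝ) (gc x) x := by
    have h := (g.contMDiff x).mdifferentiableAt (by simp)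
    exact ((mdifferentiableAt_hom_bundle _).1 h).2
  have hbase (x : M) : ∀ᶠ y in 𝓝 x, y ∈ (tr x).baseSet := (tr x).open_baseSet.mem_nhds
      (FiberBundle.mem_baseSet_trivializationAt' x)
  have hgc (x y : M) (hy : y ∈ (tr x).baseSet) (u v : E) :
      gc x y u v = g.val y ((tr x).symm y u) ((tr x).symm y v) := by
    have := inCoordinates_apply_eq₂ (E₃ := Bundle.Trivial M ℝ) (F₃ := ℝ) (ϕ := g.val y) (v := u)
      (w := v) hy hy (by trivial)
    simpa using this
  have hg (x : M) (X Y : Π y : M, TangentSpace I y) :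
      (fun y => g.val y (X y) (Y y)) =ᶠ[𝓝 x] fun y => gc x y (coord x X y) (coord x Y y) := by
    filter_upwards [hbase x] with y hy
    rw [hgc x y hy]
    simp only [coord]
    rw [(tr x).symm_apply_apply_mk hy, (tr x).symm_apply_apply_mk hy]
  have hgx (x : M) (u v : TangentSpace I x) : gc x x u v = g.val x u v := by
    have := (hg x (FiberBundle.extend E u) (FiberBundle.extend E v)).self_of_nhds
    simp only [coord_self, FiberBundle.extend_apply_self] at this
    exact this.symm
  let Dg (x : M) : E →L[ℝ] E →L[ℝ] E →L[ℝ] ℝ := mvfderiv I (gc x) x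
  have hsymm (x : M) (v u w : E) : Dg x v u w = Dg x v w u := by
    have h1 := mvfderiv_bilin (hgd x) (mdifferentiableAt_const (c := u)) (mdifferentiableAt_const (c := w)) v
    have h2 := mvfderiv_bilin (hgd x) (mdifferentiableAt_const (c := w)) (mdifferentiableAt_const (c := u)) v
    have h3 : (fun y => gc x y u w) =ᶠ[𝓝 x] fun y => gc x y w u := by
      filter_upwards [hbase x] with y hy
      rw [hgc x y hy, hgc x y hy, g.symm]
    rw [mvfderiv_congr h3, h2] at h1
    have e0 (c : E) : mvfderiv I (fun _ : M => c) x v = 0 := by rw [mvfderiv_const]; rfl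
    simp only [e0, map_zero, _root_.zero_apply, add_zero] at h1
    exact h1.symm
  have hsy (x : M) (u v : E) : gc x x u v = gc x x v u :=
    (hgx x u v).trans ((g.symm x u v).trans (hgx x v u).symm)
  have hnd (x : M) (u : E) (h : ∀ v, gc x x u v = 0) : u = 0 :=
    g.nondegenerate x u fun w => (hgx x u w).symm.trans (h w)
  choose Γ hΓs hΓ using fun x => christoffel (gc x x) (hsy x) (hnd x) (Dg x) (hsymm x)
  let dc (X : Π y : M, TangentSpace I y) (x : M) : E →L[ℝ] E := mvfderiv I (coord x X) x
  let C (X : Π y : M, TangentSpace I y) (x : M) : E →L[ℝ] E := dc X x + Γ x (X x)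
  have hC (X : Π y : M, TangentSpace I y) (x : M) (v a : E) (ha : X x = a) :
      C X x v = dc X x v + Γ x a v := by rw [← ha]; rfl
  refine ⟨⟨C, ⟨?_, ?_⟩⟩, ⟨?_, ?_⟩⟩
  · intro X Y x hX hY _
    refine ContinuousLinearMap.ext fun (v : E) => ?_
    change C (X + Y) x v = C X x v + C Y x v
    have h1 : dc (X + Y) x v = dc X x v + dc Y x v := by
      simp only [dc]
      rw [mvfderiv_congr (coord_add x X Y), mvfderiv_add (coord_mdiff hX) (coord_mdiff hY)]
      rfl
    obtain ⟨a, ha⟩ : ∃ a : E, X x = a := ⟨_, rfl⟩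
    obtain ⟨b, hb⟩ : ∃ a : E, Y x = a := ⟨_, rfl⟩
    have hab : (X + Y) x = (a + b : E) := by rw [← ha, ← hb]; rfl
    rw [hC _ x v _ hab, hC _ x v _ ha, hC _ x v _ hb, h1, map_add, add_apply]
    abel
  · intro X f x hX hf _
    refine ContinuousLinearMap.ext fun (v : E) => ?_
    obtain ⟨a, ha⟩ : ∃ a : E, X x = a := ⟨_, rfl⟩
    obtain ⟨d, hd⟩ : ∃ d : ℝ, mvfderiv I f x v = d := ⟨_, rfl⟩
    have hab : (f • X) x = (f x • a : E) := by rw [← ha]; rfl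
    have h1 : dc (f • X) x v = f x • dc X x v + d • a := by
      simp only [dc]
      rw [mvfderiv_congr (coord_smul x f X), mvfderiv_smul hf (coord_mdiff hX), coord_self, ← ha,
        ← hd]
      rfl
    have : C (f • X) x v = f x • C X x v + d • a := by
      rw [hC _ x v _ hab, hC _ x v _ ha, h1, map_smul, smul_apply]
      module
    refine this.trans ?_
    rw [← hd, ← ha]
    rfl
  · intro x X Y hX hY
    refine Eq.trans ?_ (coord_bracket x X Y hX hY)
    obtain ⟨a, ha⟩ : ∃ a : E, X x = a := ⟨_, rfl⟩
    obtain ⟨b, hb⟩ : ∃ a : E, Y x = a := ⟨_, rfl⟩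
    rw [ha, hb]
    change C Y x a - C X x b = dc Y x a - dc X x b
    rw [hC _ x _ _ ha, hC _ x _ _ hb, hΓs x b a]
    abel
  · intro x Y Z hY hZ v
    obtain ⟨a, ha⟩ : ∃ a : E, Y x = a := ⟨_, rfl⟩
    obtain ⟨b, hb⟩ : ∃ a : E, Z x = a := ⟨_, rfl⟩
    obtain ⟨w, hw⟩ : ∃ w : E, v = w := ⟨_, rfl⟩
    rw [mvfderiv_congr (hg x Y Z), mvfderiv_bilin (hgd x) (coord_mdiff hY) (coord_mdiff hZ),
      coord_self, coord_self, ← hgx, ← hgx, ha, hb, hw]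
    change Dg x w a b + gc x x (dc Y x w) b + gc x x a (dc Z x w) =
      gc x x (C Y x w) b + gc x x a (C Z x w)
    rw [hC _ x _ _ ha, hC _ x _ _ hb, hΓ x a w b, map_add, map_add, add_apply]
    ring

end existence



/-- The signs of the flat metric of index `μ` on `ℝ^(N+1)`: plus for `i = 0, …, N - μ`, minus for the
remaining `μ` indices. -/
def signature (N μ : ℕ) (i : Fin (N + 1)) : ℝ := if (i : ℕ) + μ ≤ N then 1 else -1

theorem signature_mul_self (N μ : ℕ) (i : Fin (N + 1)) :
    signature N μ i * signature N μ i = 1 := by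
  unfold signature; split_ifs <;> norm_num

/-- The flat metric `g₀ = ∑ ± dx_i²` of index `μ` on `ℝ^(N+1)`, as a bilinear form. -/
def pseudoForm (N μ : ℕ) : (Fin (N + 1) → ℝ) →L[ℝ] (Fin (N + 1) → ℝ) →L[ℝ] ℝ :=
  ∑ i, signature N μ i • (ContinuousLinearMap.proj (R := ℝ) (φ := fun _ : Fin (N + 1) => ℝ) i).smulRight
    (ContinuousLinearMap.proj (R := ℝ) (φ := fun _ : Fin (N + 1) => ℝ) i)

theorem pseudoForm_apply (N μ : ℕ) (x y : Fin (N + 1) → ℝ) :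
    pseudoForm N μ x y = ∑ i, signature N μ i * (x i * y i) := by
  simp [pseudoForm, sum_apply]

/-- The index of the flat space that contains the space form of index `l` and curvature `c = ± 1`:
`l` for `c = 1` (pseudo-sphere) and `l + 1` for `c = -1` (pseudo-hyperbolic space). -/
def ambientIndex (l : ℕ) (c : ℤˣ) : ℕ := if c = 1 then l else l + 1

/-- The hyperquadric `{p | g₀(p, p) = c}` in `ℝ^(N+1)`. -/
def hyperquadric (N l : ℕ) (c : ℤˣ) : Set (Fin (N + 1) → ℝ) :=
  {p | pseudoForm N (ambientIndex l c) p p = ((c : ℤ) : ℝ)}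

theorem unit_ne_zero (c : ℤˣ) : ((c : ℤ) : ℝ) ≠ 0 := by
  rcases Int.units_eq_one_or c with rfl | rfl <;> norm_num

section charts

variable {N l : ℕ} {c : ℤˣ}

theorem hyperquadric_ne (p : hyperquadric N l c) : ∃ i, p.1 i ≠ 0 := by
  by_contra! h
  have := p.2
  simp only [hyperquadric, Set.mem_ofPred_eq, pseudoForm_apply, h] at this
  exact unit_ne_zero c (by simpa using this.symm)

/-- The index of a nonzero coordinate of `p`. -/
def pivot (p : hyperquadric N l c) : Fin (N + 1) := (hyperquadric_ne p).choose

theorem pivot_ne (p : hyperquadric N l c) : p.1 (pivot p) ≠ 0 := (hyperquadric_ne p).choose_spec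

/-- On the hyperquadric, the square of the `i`-th coordinate as a function of the other ones. -/
def rad (l : ℕ) (c : ℤˣ) (i : Fin (N + 1)) (y : Fin N → ℝ) : ℝ :=
  signature N (ambientIndex l c) i *
    (c - ∑ j, signature N (ambientIndex l c) (i.succAbove j) * (y j * y j))

theorem mem_hyperquadric_iff (i : Fin (N + 1)) (x : Fin (N + 1) → ℝ) :
    x ∈ hyperquadric N l c ↔ x i * x i = rad l c i (fun j => x (i.succAbove j)) := by
  simp only [hyperquadric, Set.mem_ofPred_eq, pseudoForm_apply, Fin.sum_univ_succAbove _ i, rad]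
  have := signature_mul_self N (ambientIndex l c) i
  constructor
  · intro h
    rw [← h]
    linear_combination (-(x i * x i)) * this
  · intro h
    rw [h]
    linear_combination (c - ∑ j, signature N (ambientIndex l c) (i.succAbove j) *
      (x (i.succAbove j) * x (i.succAbove j))) * this

theorem continuous_rad (i : Fin (N + 1)) : Continuous (rad (N := N) l c i) := by
  unfold rad; fun_prop

/-- The hyperquadric near `p` as a graph over the coordinates other than `pivot p`. -/
def graphMap (p : hyperquadric N l c) (y : Fin N → ℝ) : Fin (N + 1) → ℝ :=
  (pivot p).insertNth (p.1 (pivot p) / |p.1 (pivot p)| * √(rad l c (pivot p) y)) y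

theorem graphMap_mem (p : hyperquadric N l c) {y : Fin N → ℝ} (hy : 0 < rad l c (pivot p) y) :
    graphMap p y ∈ hyperquadric N l c := by
  rw [mem_hyperquadric_iff (pivot p)]
  simp only [graphMap, Fin.insertNth_apply_same, Fin.insertNth_apply_succAbove]
  have h1 := Real.mul_self_sqrt hy.le
  have h2 : |p.1 (pivot p)| ≠ 0 := abs_ne_zero.2 (pivot_ne p)
  have h3 := abs_mul_abs_self (p.1 (pivot p))
  field_simp
  simp only [pow_two, h1, h3]

open Classical in
/-- The graph chart at `p`: on the part of the hyperquadric where the coordinate `pivot p` has the same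
sign as at `p`, forget that coordinate. -/
def quadricChart (p : hyperquadric N l c) :
    OpenPartialHomeomorph (hyperquadric N l c) (Fin N → ℝ) where
  toFun q j := q.1 ((pivot p).succAbove j)
  invFun y := if h : 0 < rad l c (pivot p) y then ⟨graphMap p y, graphMap_mem p h⟩ else p
  source := {q | 0 < p.1 (pivot p) * q.1 (pivot p)}
  target := {y | 0 < rad l c (pivot p) y}
  map_source' q hq := by
    rw [Set.mem_ofPred_eq] at hq ⊢
    rw [← (mem_hyperquadric_iff (pivot p) q.1).1 q.2]
    exact mul_self_pos.2 (right_ne_zero_of_mul hq.ne')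
  map_target' y hy := by
    rw [Set.mem_ofPred_eq] at hy
    simp only [hy, dite_true, Set.mem_ofPred_eq, graphMap, Fin.insertNth_apply_same]
    have h2 : 0 < |p.1 (pivot p)| := abs_pos.2 (pivot_ne p)
    have h3 := Real.sqrt_pos.2 hy
    have h4 : 0 < p.1 (pivot p) * p.1 (pivot p) := mul_self_pos.2 (pivot_ne p)
    have : p.1 (pivot p) * (p.1 (pivot p) / |p.1 (pivot p)| * √(rad l c (pivot p) y)) =
      (p.1 (pivot p) * p.1 (pivot p)) / |p.1 (pivot p)| * √(rad l c (pivot p) y) := by ring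
    rw [this]
    positivity
  left_inv' q hq := by
    rw [Set.mem_ofPred_eq] at hq
    have h1 := (mem_hyperquadric_iff (pivot p) q.1).1 q.2
    have h0 : 0 < rad l c (pivot p) (fun j => q.1 ((pivot p).succAbove j)) := by
      rw [← h1]; exact mul_self_pos.2 (right_ne_zero_of_mul hq.ne')
    simp only [h0, dite_true]
    apply Subtype.ext
    funext k
    simp only [graphMap]
    refine Fin.succAboveCases (pivot p) ?_ (fun j => ?_) k
    · rw [Fin.insertNth_apply_same, ← h1, Real.sqrt_mul_self_eq_abs]
      rcases lt_trichotomy (p.1 (pivot p)) 0 with h | h | h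
      · have : q.1 (pivot p) < 0 := by
          by_contra! h'; exact absurd hq (not_lt.2 (mul_nonpos_of_nonpos_of_nonneg h.le h'))
        rw [abs_of_neg h, abs_of_neg this]; field_simp [h.ne]
      · exact absurd h (pivot_ne p)
      · have := (pos_iff_pos_of_mul_pos hq).1 h
        rw [abs_of_pos h, abs_of_pos this]; field_simp [h.ne']
    · rw [Fin.insertNth_apply_succAbove]
  right_inv' y hy := by
    rw [Set.mem_ofPred_eq] at hy
    simp only [hy, dite_true, graphMap, Fin.insertNth_apply_succAbove]
  open_source := by
    refine isOpen_lt continuous_const (continuous_const.mul ?_)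
    exact (continuous_apply _).comp continuous_subtype_val
  open_target := isOpen_lt continuous_const (continuous_rad _)
  continuousOn_toFun := Continuous.continuousOn <|
    continuous_pi fun _ => (continuous_apply _).comp continuous_subtype_val
  continuousOn_invFun := by
    rw [Topology.IsInducing.subtypeVal.continuousOn_iff]
    have : ContinuousOn (graphMap p) {y | 0 < rad l c (pivot p) y} := by
      refine Continuous.continuousOn ?_
      unfold graphMap
      have := continuous_rad (l := l) (c := c) (pivot p)
      fun_prop
    refine this.congr fun y hy => ?_
    rw [Set.mem_ofPred_eq] at hy
    simp [hy]

/-- The manifold structure on the hyperquadric, as a hypersurface of `ℝ^(N+1)`, by graph charts. -/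
instance : ChartedSpace (Fin N → ℝ) (hyperquadric N l c) where
  atlas := Set.range quadricChart
  chartAt := quadricChart
  mem_chart_source p := mul_self_pos.2 (pivot_ne p)
  chart_mem_atlas p := ⟨p, rfl⟩

theorem contDiffOn_graphMap (p : hyperquadric N l c) :
    ContDiffOn ℝ ∞ (graphMap p) (quadricChart p).target := by
  rw [contDiffOn_pi]
  intro k
  unfold graphMap
  refine Fin.succAboveCases (pivot p) ?_ (fun j => ?_) k
  · simp only [Fin.insertNth_apply_same]
    refine contDiffOn_const.mul (ContDiffOn.sqrt ?_ fun y hy => ne_of_gt hy)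
    unfold rad
    fun_prop
  · simp only [Fin.insertNth_apply_succAbove]
    fun_prop

theorem quadricChart_symm (p : hyperquadric N l c) {y : Fin N → ℝ} (hy : y ∈ (quadricChart p).target) :
    ((quadricChart p).symm y).1 = graphMap p y := by
  have : 0 < rad l c (pivot p) y := hy
  change (Subtype.val (dite _ _ _)) = _
  simp [this]

instance : IsManifold 𝓘(ℝ, Fin N → ℝ) ∞ (hyperquadric N l c) := by
  refine isManifold_of_contDiffOn _ _ _ ?_
  rintro _ _ ⟨p, rfl⟩ ⟨q, rfl⟩
  have h : ContDiffOn ℝ ∞ (fun y j => graphMap p y ((pivot q).succAbove j))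
      (quadricChart p).target := by
    have := contDiffOn_pi.1 (contDiffOn_graphMap p)
    exact contDiffOn_pi.2 fun j => this _
  refine (h.mono ?_).congr ?_
  · intro y hy
    simp at hy
    exact hy.1
  · intro y hy
    simp at hy
    simp only [Function.comp, modelWithCornersSelf_coe, modelWithCornersSelf_coe_symm, id,
      OpenPartialHomeomorph.coe_trans]
    funext j
    change ((quadricChart p).symm y).1 _ = _
    rw [quadricChart_symm p hy.1]

theorem contMDiff_coe_hyperquadric :
   ContMDiff 𝓘(ℝ, Fin N → ℝ) 𝓘(ℝ, Fin (N + 1) → ℝ) ∞ (Subtype.val : hyperquadric N l c → _) := by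
  intro p
  rw [contMDiffAt_iff]
  refine ⟨continuous_subtype_val.continuousAt, ?_⟩
  have := (contDiffOn_graphMap p).contDiffAt ((quadricChart p).open_target.mem_nhds
    ((quadricChart p).map_source (mem_chart_source (Fin N → ℝ) p)))
  refine ContDiffAt.contDiffWithinAt ?_
  refine this.congr_of_eventuallyEq ?_
  filter_upwards [(quadricChart p).open_target.mem_nhds
    ((quadricChart p).map_source (mem_chart_source (Fin N → ℝ) p))] with y hy
  exact quadricChart_symm p hy

instance : LocallyConnectedSpace (hyperquadric N l c) :=
  ChartedSpace.locallyConnectedSpace (Fin N → ℝ) _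

/-- The semi-Riemannian space form of dimension `N`, index `l` and curvature `c = ± 1`: the connected
component of the hyperquadric that contains the point `o`. It is an open submanifold. -/
def spaceForm (N l : ℕ) (c : ℤˣ) (o : hyperquadric N l c) :
    TopologicalSpace.Opens (hyperquadric N l c) :=
  ⟨connectedComponent o, isOpen_connectedComponent⟩

end charts


/-- A metric identifies covectors with vectors. -/
theorem Metric.exists_sharp [FiniteDimensional ℝ E] (g : Metric I M) (x : M) (φ : TangentSpace I x →L[ℝ] ℝ) :
    ∃ v : TangentSpace I x, ∀ w, g.val x v w = φ w := by
  have : FiniteDimensional ℝ (TangentSpace I x) := inferInstanceAs (FiniteDimensional ℝ E)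
  let B : TangentSpace I x →ₗ[ℝ] Module.Dual ℝ (TangentSpace I x) :=
    { toFun := fun v => (g.val x v).toLinearMap
      map_add' := by intros; ext; simp
      map_smul' := by intros; ext; simp }
  have hB : Function.Injective B := by
    rw [← LinearMap.ker_eq_bot, LinearMap.ker_eq_bot']
    intro v hv
    exact g.nondegenerate x v fun w => congr($hv w)
  have hs := (LinearMap.injective_iff_surjective_of_finrank_eq_finrank
    (Subspace.dual_finrank_eq (K := ℝ) (V := TangentSpace I x)).symm).1 hB
  obtain ⟨v, hv⟩ := hs φ.toLinearMap
  exact ⟨v, fun w => congr($hv w)⟩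

/-- The Levi-Civita connection of a metric. The conditions in `IsLeviCivita` determine it on all
differentiable vector fields. -/
def Metric.leviCivita [FiniteDimensional ℝ E] (g : Metric I M) :
    CovariantDerivative I E (TangentSpace I : M → Type _) :=
  (exists_leviCivita g).choose

theorem Metric.isLeviCivita_leviCivita [FiniteDimensional ℝ E] (g : Metric I M) :
    IsLeviCivita g g.leviCivita :=
  (exists_leviCivita g).choose_spec

/-- The vector that represents a covector through the metric. -/
def Metric.sharp [FiniteDimensional ℝ E] (g : Metric I M) (x : M) (φ : TangentSpace I x →L[ℝ] ℝ) :
    TangentSpace I x :=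
  (g.exists_sharp x φ).choose

theorem Metric.val_sharp [FiniteDimensional ℝ E] (g : Metric I M) (x : M)
    (φ : TangentSpace I x →L[ℝ] ℝ) (w : TangentSpace I x) : g.val x (g.sharp x φ) w = φ w :=
  (g.exists_sharp x φ).choose_spec w

/-- The gradient of a function: `g(grad h, w) = dh(w)`. -/
def Metric.gradient [FiniteDimensional ℝ E] (g : Metric I M) (h : M → ℝ) (x : M) :
    TangentSpace I x :=
  g.sharp x (mvfderiv I h x)

/-- The curvature operator `R(X, Y) Z = D_X D_Y Z - D_Y D_X Z - D_[X, Y] Z` of a connection. -/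
def curvature (D : CovariantDerivative I E (TangentSpace I : M → Type _))
    (X Y Z : Π x : M, TangentSpace I x) (x : M) : TangentSpace I x :=
  D (fun y ↦ D Z y (Y y)) x (X x) - D (fun y ↦ D Z y (X y)) x (Y x) -
    D Z x (VectorField.mlieBracket I X Y x)

/-- The curvature tensor `R(X, Y, Z, W) = g(R(X, Y) Z, W)` of a metric. -/
def Metric.curvatureTensor [FiniteDimensional ℝ E] (g : Metric I M)
    (X Y Z W : Π x : M, TangentSpace I x) (x : M) : ℝ :=
  g.val x (curvature g.leviCivita X Y Z x) (W x)

/-- A smooth vector field. -/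
def IsSmoothField (I : ModelWithCorners ℝ E H) {M : Type*} [TopologicalSpace M] [ChartedSpace H M]
    [IsManifold I ∞ M] (X : Π x : M, TangentSpace I x) : Prop :=
  ContMDiff I I.tangent ∞ (fun x ↦ (⟨x, X x⟩ : TangentBundle I M))

section immersions

variable {E₂ : Type*} [NormedAddCommGroup E₂] [NormedSpace ℝ E₂]
  {H₂ : Type*} [TopologicalSpace H₂] {I₂ : ModelWithCorners ℝ E₂ H₂}
  {M₂ : Type*} [TopologicalSpace M₂] [ChartedSpace H₂ M₂] [IsManifold I₂ ∞ M₂]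

/-- `f` is an isometric immersion of `(M, g)` into `(M₂, g₂)`. -/
structure IsIsometricImmersion (g : Metric I M) (g₂ : Metric I₂ M₂) (f : M → M₂) : Prop where
  contMDiff : ContMDiff I I₂ ∞ f
  injective (x : M) : Function.Injective (mfderiv I I₂ f x)
  isometric (x : M) (u v : TangentSpace I x) :
    g₂.val (f x) (mfderiv I I₂ f x u) (mfderiv I I₂ f x v) = g.val x u v

/-- The connection induced by `D` on vector fields along `f`, applied to the field `V` and the
tangent vector `u` at `x`. If `e_i` is the coordinate frame centred at `f x` and `V = ∑ V^i e_i`, this is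
`∑ dV^i(u) e_i + ∑ V^i D_{df(u)} e_i`; the first sum is the first term below, and
`FiberBundle.extend E₂ (V x)` is the field `∑ V^i(x) e_i` near `f x`. -/
def covDerivAlong (I : ModelWithCorners ℝ E H) [IsManifold I ∞ M]
    (D : CovariantDerivative I₂ E₂ (TangentSpace I₂ : M₂ → Type _)) (f : M → M₂)
    (V : Π x : M, TangentSpace I₂ (f x)) (x : M) (u : TangentSpace I x) : TangentSpace I₂ (f x) :=
  (trivializationAt E₂ (TangentSpace I₂ : M₂ → Type _) (f x)).symm (f x)
      (mvfderiv I (fun y ↦ (trivializationAt E₂ (TangentSpace I₂ : M₂ → Type _) (f x)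
        ⟨f y, V y⟩).2) x u) +
    D (FiberBundle.extend E₂ (V x)) (f x) (mfderiv I I₂ f x u)

/-- The tangential part of an ambient vector `w` at `f x`, as a tangent vector of `M`: the vector `v`
with `g(v, u) = g₂(w, df u)` for all `u`. -/
def tangentialPart [FiniteDimensional ℝ E] (g : Metric I M) (g₂ : Metric I₂ M₂) (f : M → M₂) (x : M)
    (w : TangentSpace I₂ (f x)) : TangentSpace I x :=
  g.sharp x (g₂.val (f x) w ∘L mfderiv I I₂ f x)

/-- The part of an ambient vector `w` at `f x` that is normal to the immersion `f`. -/
def normalPart [FiniteDimensional ℝ E] (g : Metric I M) (g₂ : Metric I₂ M₂) (f : M → M₂) (x : M)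
    (w : TangentSpace I₂ (f x)) : TangentSpace I₂ (f x) :=
  w - mfderiv I I₂ f x (tangentialPart g g₂ f x w)

/-- The second fundamental form `α(X, Y)` of an isometric immersion `f`: the normal part of the
ambient derivative of `df(Y)` in the direction of `X`. -/
def secondFundamentalForm [FiniteDimensional ℝ E] [FiniteDimensional ℝ E₂] (g : Metric I M)
    (g₂ : Metric I₂ M₂) (f : M → M₂) (X Y : Π x : M, TangentSpace I x) (x : M) :
    TangentSpace I₂ (f x) :=
  normalPart g g₂ f x
    (covDerivAlong I g₂.leviCivita f (fun y ↦ mfderiv I I₂ f y (Y y)) x (X x))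

end immersions

section pullbackForm

variable {V : Type*} [NormedAddCommGroup V] [NormedSpace ℝ V]

/-- The pull-back `B_x (dF_x u, dF_x v)` of a field of bilinear forms along `F : M → V`. -/
def pullbackForm (I : ModelWithCorners ℝ E H) (F : M → V) (B : M → V →L[ℝ] V →L[ℝ] ℝ) (x : M) :
    TangentSpace I x →L[ℝ] TangentSpace I x →L[ℝ] ℝ :=
  ContinuousLinearMap.precomp ℝ (mvfderiv I F x) ∘L B x ∘L mvfderiv I F x

theorem contMDiff_pullbackForm {F : M → V} (hF : ContMDiff I 𝓘(ℝ, V) ∞ F)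
    {B : M → V →L[ℝ] V →L[ℝ] ℝ} (hB : ContMDiff I 𝓘(ℝ, V →L[ℝ] V →L[ℝ] ℝ) ∞ B) :
    ContMDiff I (I.prod 𝓘(ℝ, E →L[ℝ] E →L[ℝ] ℝ)) ∞
      (fun x ↦ TotalSpace.mk' (E →L[ℝ] E →L[ℝ] ℝ) (E := fun x : M => TangentSpace I x →L[ℝ]
        TangentSpace I x →L[ℝ] ℝ) x (pullbackForm I F B x)) := by
  intro x
  rw [contMDiffAt_hom_bundle]
  refine ⟨contMDiffAt_id, ?_⟩
  have hA := (hF x).mfderiv_const (m := ∞) le_rfl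
  set A : M → E →L[ℝ] V := inTangentCoordinates I 𝓘(ℝ, V) id F (mfderiv I 𝓘(ℝ, V) F) x with hAdef
  have h := (hA.clm_precomp (F₃ := ℝ)).clm_comp ((hB x).clm_comp hA)
  refine h.congr_of_eventuallyEq ?_
  filter_upwards [(trivializationAt E (TangentSpace I : M → Type _) x).open_baseSet.mem_nhds
      (FiberBundle.mem_baseSet_trivializationAt' x)] with y hy
  have hAy (u : E) : A y u = mvfderiv I F y
      ((trivializationAt E (TangentSpace I : M → Type _) x).symm y u) := by
    rw [hAdef]
    simp only [inTangentCoordinates, ContinuousLinearMap.inCoordinates, id]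
    rw [TangentBundle.continuousLinearMapAt_model_space]
    change mvfderiv I F y (Trivialization.symmL ℝ (trivializationAt E (TangentSpace I) x) y u) = _
    rw [Trivialization.symmL_apply]
    exact hy
  refine ContinuousLinearMap.ext fun u => ContinuousLinearMap.ext fun v => ?_
  have := inCoordinates_apply_eq₂ (E₃ := Bundle.Trivial M ℝ) (F₃ := ℝ)
    (ϕ := pullbackForm I F B y) (v := u) (w := v) hy hy (by trivial)
  refine this.trans ?_
  change _ = B y (A y u) (A y v)
  rw [hAy, hAy]
  simp
  rfl

theorem contMDiff_pullbackForm_add {V' : Type*} [NormedAddCommGroup V'] [NormedSpace ℝ V']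
    {F : M → V} (hF : ContMDiff I 𝓘(ℝ, V) ∞ F)
    {B : M → V →L[ℝ] V →L[ℝ] ℝ} (hB : ContMDiff I 𝓘(ℝ, V →L[ℝ] V →L[ℝ] ℝ) ∞ B)
    {F' : M → V'} (hF' : ContMDiff I 𝓘(ℝ, V') ∞ F')
    {B' : M → V' →L[ℝ] V' →L[ℝ] ℝ} (hB' : ContMDiff I 𝓘(ℝ, V' →L[ℝ] V' →L[ℝ] ℝ) ∞ B') :
    ContMDiff I (I.prod 𝓘(ℝ, E →L[ℝ] E →L[ℝ] ℝ)) ∞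
      (fun x ↦ TotalSpace.mk' (E →L[ℝ] E →L[ℝ] ℝ) (E := fun x : M => TangentSpace I x →L[ℝ]
        TangentSpace I x →L[ℝ] ℝ) x (pullbackForm I F B x + pullbackForm I F' B' x)) :=
  ContMDiff.add_section (contMDiff_pullbackForm hF hB) (contMDiff_pullbackForm hF' hB')

end pullbackForm

section warped

variable {N l : ℕ} {c : ℤˣ}

/-- The manifold `J × M` of a warped product, `J` an open set of reals and `M` the space form. -/
abbrev WarpedProduct (J : TopologicalSpace.Opens ℝ) (o : hyperquadric N l c) : Type :=
  J × spaceForm N l c o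

/-- The model with corners of `J × M`. -/
abbrev warpedModel (N : ℕ) : ModelWithCorners ℝ (ℝ × (Fin N → ℝ)) (ModelProd ℝ (Fin N → ℝ)) :=
  𝓘(ℝ, ℝ).prod 𝓘(ℝ, Fin N → ℝ)

variable {J : TopologicalSpace.Opens ℝ} {o : hyperquadric N l c}

/-- The projection `(t, x) ↦ t` of the warped product to the line. -/
def time (p : WarpedProduct J o) : ℝ := p.1
/-- The projection `(t, x) ↦ x`, with values in `ℝ^(N+1)`. -/
def space (p : WarpedProduct J o) : Fin (N + 1) → ℝ := p.2.1.1

theorem contMDiff_time : ContMDiff (warpedModel N) 𝓘(ℝ, ℝ) ∞ (time (J := J) (o := o)) :=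
  contMDiff_subtype_val.comp contMDiff_fst

theorem contMDiff_space :
    ContMDiff (warpedModel N) 𝓘(ℝ, Fin (N + 1) → ℝ) ∞ (space (J := J) (o := o)) :=
  contMDiff_coe_hyperquadric.comp (contMDiff_subtype_val.comp contMDiff_snd)

theorem mvfderiv_time (p : WarpedProduct J o) (u : TangentSpace (warpedModel N) p) :
    mvfderiv (warpedModel N) time p u = u.1 := by
  have h1 := (mdifferentiableAt_extChartAt (I := warpedModel N) (mem_chart_source _ p))
  have h2 := ((ContinuousLinearMap.fst ℝ ℝ (Fin N → ℝ)).hasMFDerivAt (x := extChartAt (warpedModel N) p p)).comp p h1.hasMFDerivAt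
  rw [mfderiv_extChartAt_self] at h2
  have h3 := h2.mfderiv
  exact congr($h3 u)

theorem mvfderiv_space (p : WarpedProduct J o) (u : TangentSpace (warpedModel N) p) (j : Fin N) :
    mvfderiv (warpedModel N) space p u ((pivot p.2.1).succAbove j) = u.2 j := by
  have h1 := (mdifferentiableAt_extChartAt (I := warpedModel N) (mem_chart_source _ p))
  have h2 := ((ContinuousLinearMap.proj (R := ℝ) (φ := fun _ : Fin N => ℝ) j ∘L
    ContinuousLinearMap.snd ℝ ℝ (Fin N → ℝ)).hasMFDerivAt
      (x := extChartAt (warpedModel N) p p)).comp p h1.hasMFDerivAt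
  rw [mfderiv_extChartAt_self] at h2
  have h4 := ((contMDiff_space (J := J) (o := o)) p).mdifferentiableAt (by simp)
  have h5 := ((ContinuousLinearMap.proj (R := ℝ) (φ := fun _ : Fin (N + 1) => ℝ)
    ((pivot p.2.1).succAbove j)).hasMFDerivAt (x := space p)).comp p h4.hasMFDerivAt
  exact congr($(h5.mfderiv.symm.trans h2.mfderiv) u)

theorem pseudoForm_comm (N μ : ℕ) (x y) : pseudoForm N μ x y = pseudoForm N μ y x := by
  simp only [pseudoForm_apply, mul_comm]

theorem pseudoForm_space (p : WarpedProduct J o) (u : TangentSpace (warpedModel N) p) :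
    pseudoForm N (ambientIndex l c) (mvfderiv (warpedModel N) space p u) (space p) = 0 := by
  have h4 := ((contMDiff_space (J := J) (o := o)) p).mdifferentiableAt (by simp)
  have h := mvfderiv_bilin (mdifferentiableAt_const (c := pseudoForm N (ambientIndex l c))) h4 h4 u
  have h1 : (fun q : WarpedProduct J o => pseudoForm N (ambientIndex l c) (space q) (space q)) =
      fun _ => ((c : ℤ) : ℝ) := funext fun q => q.2.1.2
  have e0 {F : Type} [NormedAddCommGroup F] [NormedSpace ℝ F] (k : F) :
      mvfderiv (warpedModel N) (fun _ : WarpedProduct J o => k) p u = 0 := by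
    rw [mvfderiv_const]; rfl
  rw [h1, e0, e0, pseudoForm_comm _ _ (space p)] at h
  simp only [_root_.zero_apply, zero_add] at h
  linarith

theorem pseudoForm_nondegenerate (N μ : ℕ) (x : Fin (N + 1) → ℝ) (h : ∀ y, pseudoForm N μ x y = 0) :
    x = 0 := by
  funext i
  have := h (Pi.single i 1)
  rw [pseudoForm_apply, Finset.sum_eq_single i (by intro j _ hj; simp [hj]) (by simp)] at this
  have h2 := signature_mul_self N μ i
  simp only [Pi.single_eq_same, mul_one] at this
  simpa using (mul_eq_zero.1 this).resolve_left fun h0 => by rw [h0] at h2; norm_num at h2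

theorem exists_tangent (p : WarpedProduct J o) (s : ℝ) (z : Fin (N + 1) → ℝ)
    (hz : pseudoForm N (ambientIndex l c) z (space p) = 0) :
    ∃ u : TangentSpace (warpedModel N) p, mvfderiv (warpedModel N) time p u = s ∧
      mvfderiv (warpedModel N) space p u = z := by
  let u : TangentSpace (warpedModel N) p := ((s, fun j => z ((pivot p.2.1).succAbove j)) : ℝ × (Fin N → ℝ))
  refine ⟨u, mvfderiv_time p u, ?_⟩
  have h1 := mvfderiv_space p u
  have h2 := pseudoForm_space p u
  generalize mvfderiv (warpedModel N) space p u = x at h1 h2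
  have h3 : ∀ j, x ((pivot p.2.1).succAbove j) = z ((pivot p.2.1).succAbove j) := h1
  rw [pseudoForm_apply, Fin.sum_univ_succAbove _ (pivot p.2.1)] at h2 hz
  simp only [h3] at h2
  have h4 := signature_mul_self N (ambientIndex l c) (pivot p.2.1)
  have h5 : space p (pivot p.2.1) ≠ 0 := pivot_ne p.2.1
  funext k
  refine Fin.succAboveCases (pivot p.2.1) ?_ h3 k
  have h6 : signature N (ambientIndex l c) (pivot p.2.1) ≠ 0 := fun h0 => by
    rw [h0] at h4; norm_num at h4
  exact mul_right_cancel₀ h5 (mul_left_cancel₀ h6 (by linarith))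

/-- The warped product metric `ε dt² + a(t)² g` on `J × M`, where `g` is the metric that the flat metric
`g₀` of `ℝ^(N+1)` induces on the space form `M`. -/
def warpedMetric (ε : ℤˣ) (J : TopologicalSpace.Opens ℝ) (a : ℝ → ℝ) (ha : ContDiffOn ℝ ∞ a J)
    (hpos : ∀ t ∈ J, 0 < a t) (o : hyperquadric N l c) :
    Metric (warpedModel N) (WarpedProduct J o) where
  val p := pullbackForm (warpedModel N) time (fun _ => ((ε : ℤ) : ℝ) • ContinuousLinearMap.mul ℝ ℝ) p +
    pullbackForm (warpedModel N) space
      (fun q => a (time q) ^ 2 • pseudoForm N (ambientIndex l c)) p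
  symm p u v := by
    change ((ε : ℤ) : ℝ) • (_ * _) + a (time p) ^ 2 • pseudoForm N _ _ _ = ((ε : ℤ) : ℝ) • (_ * _) + a (time p) ^ 2 • pseudoForm N _ _ _
    rw [mul_comm, pseudoForm_comm]
  nondegenerate p u hu := by
    have hu' (v : TangentSpace (warpedModel N) p) :
        ((ε : ℤ) : ℝ) * (mvfderiv (warpedModel N) time p u * mvfderiv (warpedModel N) time p v) +
          a (time p) ^ 2 * pseudoForm N (ambientIndex l c) (mvfderiv (warpedModel N) space p u)
            (mvfderiv (warpedModel N) space p v) = 0 := hu v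
    have hap : a (time p) ^ 2 ≠ 0 := (pow_pos (hpos _ p.1.2) 2).ne'
    have h1 : mvfderiv (warpedModel N) time p u = 0 := by
      obtain ⟨v, hv1, hv2⟩ := exists_tangent p 1 0 (by simp)
      have := hu' v
      rw [hv1, hv2] at this
      simpa [unit_ne_zero ε] using this
    have h2 : mvfderiv (warpedModel N) space p u = 0 := by
      refine pseudoForm_nondegenerate N (ambientIndex l c) _ fun y => ?_
      have hp : pseudoForm N (ambientIndex l c) (space p) (space p) = ((c : ℤ) : ℝ) := p.2.1.2
      obtain ⟨v, hv1, hv2⟩ := exists_tangent p 0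
        (y - (pseudoForm N (ambientIndex l c) y (space p) / ((c : ℤ) : ℝ)) • space p) (by
          rw [map_sub, map_smul, sub_apply, smul_apply, hp, smul_eq_mul,
            div_mul_cancel₀ _ (unit_ne_zero c), sub_self])
      have := hu' v
      rw [hv1, hv2, map_sub, map_smul, pseudoForm_space] at this
      simpa [hap] using this
    have h3 := mvfderiv_time p u
    have h4 := mvfderiv_space p u
    rw [h1] at h3
    rw [h2] at h4
    exact Prod.ext h3.symm (funext fun j => (h4 j).symm)
  contMDiff := by
    have : ContMDiff (warpedModel N) 𝓘(ℝ, ℝ) ∞ fun q : WarpedProduct J o => a (time q) := by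
      intro q
      have h := (ha.contDiffAt (J.isOpen.mem_nhds q.1.2)).contMDiffAt
      exact h.comp q (contMDiff_time q)
    exact contMDiff_pullbackForm_add contMDiff_time contMDiff_const contMDiff_space
      ((this.pow 2).smul contMDiff_const)

end warped

end SemiRiemannian

end

/-!
Embed the warped product in `ℝ × ℝ^(N+1)`. On a hypersurface of a vector space whose tangent spaces
are the kernels of a covector field, a connection is a field `Γ` of bilinear maps of the ambient
space: it differentiates a tangent vector field `z` to `dz + Γ(·, z)`, and its curvature is the
tensor `R(u, v)y = dΓ(u)(v, y) - dΓ(v)(u, y) + Γ(u, Γ(v, y)) - Γ(v, Γ(u, y))`. Composing an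
immersion into the warped product with the embedding turns vector fields along the immersion into
vector-valued functions. The Gauss formula `∇_v dΦ(Y) = dΦ(∇_v Y) + α(v, Y)` then determines the
Levi-Civita connection of the immersed manifold, and differentiating it once more gives the Gauss
equation with ambient term `⟨R(dΦ X, dΦ Y) dΦ Z, dΦ W⟩`. It remains to evaluate `R` for the warped
product, where
`Γ(u, v) = (-ε a a' ⟨u₂, v₂⟩, (a'/a) (u₁ v₂ + v₁ u₂) + c ⟨u₂, v₂⟩ x)` at the point `(t, x)`.
-/

noncomputable section

namespace SemiRiemannian

section calculus

variable {E : Type*} [NormedAddCommGroup E] [NormedSpace ℝ E]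
  {H : Type*} [TopologicalSpace H] {I : ModelWithCorners ℝ E H}
  {M : Type*} [TopologicalSpace M] [ChartedSpace H M]
  {V V' : Type*} [NormedAddCommGroup V] [NormedSpace ℝ V]
  [NormedAddCommGroup V'] [NormedSpace ℝ V'] {x : M}

theorem mdifferentiableAt_comp_of_differentiableAt {φ : V → V'} {F : M → V}
    (hφ : DifferentiableAt ℝ φ (F x)) (hF : MDiffAt F x) : MDiffAt (fun y ↦ φ (F y)) x :=
  hφ.comp_mdifferentiableAt hF

theorem mvfderiv_fderiv_comp {φ : V → V'} {F : M → V} (hφ : DifferentiableAt ℝ φ (F x))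
    (hF : MDiffAt F x) (v : TangentSpace I x) :
    mvfderiv I (fun y ↦ φ (F y)) x v = fderiv ℝ φ (F x) (mvfderiv I F x v) := by
  have h := mfderiv_comp_apply x hφ.mdifferentiableAt hF v
  rwa [mfderiv_eq_fderiv] at h

theorem mvfderiv_mfderiv_comp {E₂ : Type*} [NormedAddCommGroup E₂] [NormedSpace ℝ E₂]
    {H₂ : Type*} [TopologicalSpace H₂] {I₂ : ModelWithCorners ℝ E₂ H₂}
    {M₂ : Type*} [TopologicalSpace M₂] [ChartedSpace H₂ M₂] {f : M → M₂} {F : M₂ → V}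
    (hF : MDiffAt F (f x)) (hf : MDiffAt f x) (v : TangentSpace I x) :
    mvfderiv I (fun y ↦ F (f y)) x v = mvfderiv I₂ F (f x) (mfderiv I I₂ f x v) :=
  mfderiv_comp_apply x hF hf v

theorem mvfderiv_prodMk {F : M → V} {G : M → V'} (hF : MDiffAt F x) (hG : MDiffAt G x)
    (v : TangentSpace I x) :
    mvfderiv I (fun y ↦ (F y, G y)) x v = (mvfderiv I F x v, mvfderiv I G x v) := by
  have hFG := hF.prodMk_space hG
  have h₁ := mvfderiv_fderiv_comp (φ := Prod.fst) differentiableAt_fst hFG v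
  have h₂ := mvfderiv_fderiv_comp (φ := Prod.snd) differentiableAt_snd hFG v
  rw [fderiv_fst] at h₁
  rw [fderiv_snd] at h₂
  exact Prod.ext h₁.symm h₂.symm

theorem mvfderiv_clm_apply {G : M → V →L[ℝ] V'} {b : M → V} (hG : MDiffAt G x) (hb : MDiffAt b x)
    (v : TangentSpace I x) :
    mvfderiv I (fun y ↦ G y (b y)) x v = mvfderiv I G x v (b x) + G x (mvfderiv I b x v) := by
  have hφ : HasFDerivAt (fun p : (V →L[ℝ] V') × V ↦ p.1 p.2) _ (G x, b x) :=
    hasFDerivAt_fst.clm_apply hasFDerivAt_snd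
  have h := mvfderiv_fderiv_comp (F := fun y ↦ (G y, b y)) hφ.differentiableAt
    (hG.prodMk_space hb) v
  rw [mvfderiv_prodMk hG hb, hφ.fderiv] at h
  exact h.trans (add_comm _ _)

theorem mvfderiv_clm_apply₂ {V'' : Type*} [NormedAddCommGroup V''] [NormedSpace ℝ V'']
    {G : M → V →L[ℝ] V' →L[ℝ] V''} {b : M → V} {b' : M → V'} (hG : MDiffAt G x) (hb : MDiffAt b x)
    (hb' : MDiffAt b' x) (v : TangentSpace I x) :
    mvfderiv I (fun y ↦ G y (b y) (b' y)) x v = mvfderiv I G x v (b x) (b' x) +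
      G x (mvfderiv I b x v) (b' x) + G x (b x) (mvfderiv I b' x v) := by
  rw [mvfderiv_clm_apply (hG.clm_apply hb) hb', mvfderiv_clm_apply hG hb, add_apply]

set_option synthInstance.maxHeartbeats 100000 in
-- Instance search is slow on the nested spaces of operators.
theorem mvfderiv_comp_clm_apply₂ {U V'' : Type*} [NormedAddCommGroup U] [NormedSpace ℝ U]
    [NormedAddCommGroup V''] [NormedSpace ℝ V''] {φ : U → V →L[ℝ] V' →L[ℝ] V''} {F : M → U}
    {b : M → V} {b' : M → V'} (hφ : DifferentiableAt ℝ φ (F x)) (hF : MDiffAt F x)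
    (hb : MDiffAt b x) (hb' : MDiffAt b' x) (v : TangentSpace I x) :
    mvfderiv I (fun y ↦ φ (F y) (b y) (b' y)) x v =
      fderiv ℝ φ (F x) (mvfderiv I F x v) (b x) (b' x) +
        φ (F x) (mvfderiv I b x v) (b' x) + φ (F x) (b x) (mvfderiv I b' x v) := by
  rw [mvfderiv_clm_apply₂ (mdifferentiableAt_comp_of_differentiableAt hφ hF) hb hb',
    mvfderiv_fderiv_comp hφ hF]

theorem mdifferentiableAt_of_clm_apply [CompleteSpace V] {A : M → V →L[ℝ] V'} {u : M → V}
    (hA : MDiffAt A x) (hAx : (A x).IsInvertible) (h : MDiffAt (fun y ↦ A y (u y)) x) :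
    MDiffAt u x := by
  obtain ⟨e, he⟩ := hAx
  have hinv : DifferentiableAt ℝ
      (ContinuousLinearMap.inverse : (V →L[ℝ] V') → V' →L[ℝ] V) (A x) := by
    rw [← he]
    exact (contDiffAt_map_inverse (n := 1) e).differentiableAt (by simp)
  refine ((hinv.mdifferentiableAt.comp x hA).clm_apply h).congr_of_eventuallyEq ?_
  filter_upwards [hA.continuousAt.eventually (he ▸ e.nhds)] with y ⟨e', he'⟩
  simp only [Function.comp_apply]
  rw [← he', ContinuousLinearMap.inverse_equiv]
  exact (e'.symm_apply_apply _).symm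

theorem mdifferentiableAt_of_forall_apply [FiniteDimensional ℝ V] {A : M → V →L[ℝ] V'}
    (h : ∀ w, MDiffAt (fun y ↦ A y w) x) : MDiffAt A x := by
  let b := Module.finBasis ℝ V
  have hA : A = ∑ i, fun y ↦
      ContinuousLinearMap.smulRightL ℝ V V' (LinearMap.toContinuousLinearMap (b.coord i))
        (A y (b i)) := by
    funext y
    ext w
    conv_lhs => rw [← b.sum_repr w, map_sum]
    simp
  rw [hA]
  exact MDifferentiableAt.sum fun i _ ↦
    (ContinuousLinearMap.mdifferentiableAt _).comp x (h (b i))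

end calculus

section frames

variable {E : Type*} [NormedAddCommGroup E] [NormedSpace ℝ E]
  {H : Type*} [TopologicalSpace H] {I : ModelWithCorners ℝ E H}
  {M : Type*} [TopologicalSpace M] [ChartedSpace H M] [IsManifold I ∞ M]
  {V : Type*} [NormedAddCommGroup V] [NormedSpace ℝ V] {F : M → V} {x : M}
  {X Y : Π y : M, TangentSpace I y}

theorem trivializationAt_snd_self (x : M) (u : TangentSpace I x) :
    (trivializationAt E (TangentSpace I) x ⟨x, u⟩).2 = u := by
  have h := coord_self x (FiberBundle.extend E u)
  rwa [coord, FiberBundle.extend_apply_self] at h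

theorem trivializationAt_symm_self (x : M) (u : E) :
    (trivializationAt E (TangentSpace I : M → Type _) x).symm x u = u := by
  have h := (trivializationAt E (TangentSpace I : M → Type _) x).symm_apply_apply_mk
    (FiberBundle.mem_baseSet_trivializationAt' x) (u : TangentSpace I x)
  exact (congrArg _ (trivializationAt_snd_self x u)).symm.trans h

theorem eventually_mem_baseSet (x : M) :
    ∀ᶠ q in 𝓝 x, q ∈ (trivializationAt E (TangentSpace I : M → Type _) x).baseSet :=
  (trivializationAt E (TangentSpace I : M → Type _) x).open_baseSet.mem_nhds
    (FiberBundle.mem_baseSet_trivializationAt' x)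

theorem coord_extend (x : M) (w : TangentSpace I x) :
    coord x (FiberBundle.extend E w) =ᶠ[𝓝 x]
      fun _ ↦ (trivializationAt E (TangentSpace I) x ⟨x, w⟩).2 := by
  filter_upwards [eventually_mem_baseSet (I := I) x] with q hq
  have h := (trivializationAt E (TangentSpace I : M → Type _) x).apply_mk_symm hq
    (trivializationAt E (TangentSpace I) x ⟨x, w⟩).2
  exact (congrArg Prod.snd h :)

/-- The differential of `F` at `q`, read in the coordinate frame centred at `x`. -/
def frameDeriv (I : ModelWithCorners ℝ E H) [IsManifold I ∞ M] (F : M → V) (x q : M) : E →L[ℝ] V :=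
  mvfderiv I F q ∘L (trivializationAt E (TangentSpace I : M → Type _) x).symmL ℝ q

theorem frameDeriv_apply (F : M → V) {q : M}
    (hq : q ∈ (trivializationAt E (TangentSpace I : M → Type _) x).baseSet) (u : E) :
    frameDeriv I F x q u =
      mvfderiv I F q ((trivializationAt E (TangentSpace I : M → Type _) x).symm q u) := by
  rw [frameDeriv, ContinuousLinearMap.comp_apply, Trivialization.symmL_apply]
  exact hq

theorem frameDeriv_trivializationAt (F : M → V) {q : M}
    (hq : q ∈ (trivializationAt E (TangentSpace I : M → Type _) x).baseSet)
    (u : TangentSpace I q) :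
    frameDeriv I F x q (trivializationAt E (TangentSpace I) x ⟨q, u⟩).2 = mvfderiv I F q u := by
  rw [frameDeriv_apply F hq, Trivialization.symm_apply_apply_mk _ hq]

theorem frameDeriv_self (F : M → V) (x : M) (u : TangentSpace I x) :
    frameDeriv I F x x u = mvfderiv I F x u := by
  rw [← frameDeriv_trivializationAt F (FiberBundle.mem_baseSet_trivializationAt' x) u,
    trivializationAt_snd_self]

theorem contMDiffAt_frameDeriv (hF : CMDiff ∞ F) (x : M) :
    ContMDiffAt I 𝓘(ℝ, E →L[ℝ] V) ∞ (frameDeriv I F x) x := by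
  refine ((hF x).mfderiv_const (m := ∞) le_rfl).congr_of_eventuallyEq ?_
  filter_upwards [eventually_mem_baseSet (I := I) x] with y hy
  ext u
  rw [frameDeriv_apply F hy]
  simp only [inTangentCoordinates, ContinuousLinearMap.inCoordinates, id]
  rw [TangentBundle.continuousLinearMapAt_model_space]
  change _ = mvfderiv I F y (Trivialization.symmL ℝ (trivializationAt E (TangentSpace I) x) y u)
  rw [Trivialization.symmL_apply]
  exact hy

theorem mdifferentiableAt_frameDeriv (hF : CMDiff ∞ F) (x : M) :
    MDiffAt (frameDeriv I F x) x :=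
  (contMDiffAt_frameDeriv hF x).mdifferentiableAt (by simp)

theorem frameDeriv_extChartAt_symm [I.Boundaryless] (hF : CMDiff ∞ F) (x : M) :
    ∀ᶠ y in 𝓝 (extChartAt I x x), frameDeriv I F x ((extChartAt I x).symm y) =
      fderiv ℝ (F ∘ (extChartAt I x).symm) y := by
  filter_upwards [extChartAt_target_mem_nhds (I := I) x] with y hy
  have hs : (extChartAt I x).symm y ∈ (chartAt H x).source := by
    rw [← extChartAt_source I]
    exact (extChartAt I x).map_target hy
  have hsymm : MDifferentiableAt 𝓘(ℝ, E) I (extChartAt I x).symm y := by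
    have h := mdifferentiableWithinAt_extChartAt_symm (I := I) hy
    rwa [I.range_eq_univ, mdifferentiableWithinAt_univ] at h
  rw [frameDeriv, TangentBundle.symmL_trivializationAt hs, (extChartAt I x).right_inv hy,
    I.range_eq_univ, mfderivWithin_univ, ← mfderiv_eq_fderiv]
  exact (mfderiv_comp y ((hF _).mdifferentiableAt (by simp)) hsymm).symm

theorem mvfderiv_frameDeriv_symm [I.Boundaryless] (hF : CMDiff ∞ F) (x : M) (u v : E) :
    mvfderiv I (frameDeriv I F x) x u v = mvfderiv I (frameDeriv I F x) x v u := by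
  have hF₂ : ContDiffAt ℝ ∞ (F ∘ (extChartAt I x).symm) (extChartAt I x x) := by
    have h := (contMDiffAt_iff.1 (hF x)).2
    rwa [I.range_eq_univ, contDiffWithinAt_univ] at h
  have hd : writtenInExtChartAt I 𝓘(ℝ, E →L[ℝ] V) x (frameDeriv I F x) =ᶠ[𝓝 (extChartAt I x x)]
      fderiv ℝ (F ∘ (extChartAt I x).symm) := frameDeriv_extChartAt_symm hF x
  rw [(mdifferentiableAt_frameDeriv hF x).mvfderiv, I.range_eq_univ, fderivWithin_univ,
    hd.fderiv_eq]
  exact hF₂.isSymmSndFDerivAt (by simpa using! (mod_cast le_top : ((2 : ℕ∞) : WithTop ℕ∞) ≤ ∞)) u v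

section along

variable {E₁ : Type*} [NormedAddCommGroup E₁] [NormedSpace ℝ E₁]
  {H₁ : Type*} [TopologicalSpace H₁] {I₁ : ModelWithCorners ℝ E₁ H₁}
  {M₁ : Type*} [TopologicalSpace M₁] [ChartedSpace H₁ M₁] {f : M₁ → M} {p : M₁}
  {U : Π y : M₁, TangentSpace I (f y)}

theorem mvfderiv_along_eq_frameDeriv (F : M → V) (hf : ContinuousAt f p) :
    (fun y ↦ mvfderiv I F (f y) (U y)) =ᶠ[𝓝 p] fun y ↦ frameDeriv I F (f p) (f y)
      (trivializationAt E (TangentSpace I) (f p) ⟨f y, U y⟩).2 := by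
  filter_upwards [hf.eventually (eventually_mem_baseSet (I := I) (f p))] with y hy
  exact (frameDeriv_trivializationAt F hy _).symm

theorem mdifferentiableAt_mvfderiv_along (hF : CMDiff ∞ F)
    (hU : MDifferentiableAt I₁ I.tangent (fun y ↦ (⟨f y, U y⟩ : TangentBundle I M)) p) :
    MDiffAt (fun y ↦ mvfderiv I F (f y) (U y)) p := by
  obtain ⟨hf, hU⟩ := (mdifferentiableAt_totalSpace ..).1 hU
  exact (((mdifferentiableAt_frameDeriv hF (f p)).comp p hf).clm_apply hU).congr_of_eventuallyEq
    (mvfderiv_along_eq_frameDeriv F hf.continuousAt)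

theorem mvfderiv_mvfderiv_along [IsManifold I₁ ∞ M₁] (hF : CMDiff ∞ F)
    (hU : MDifferentiableAt I₁ I.tangent (fun y ↦ (⟨f y, U y⟩ : TangentBundle I M)) p)
    (v : TangentSpace I₁ p) :
    mvfderiv I₁ (fun y ↦ mvfderiv I F (f y) (U y)) p v =
      mvfderiv I (frameDeriv I F (f p)) (f p) (mfderiv I₁ I f p v) (U p) +
      mvfderiv I F (f p) (mvfderiv I₁
        (fun y ↦ (trivializationAt E (TangentSpace I) (f p) ⟨f y, U y⟩).2) p v) := by
  obtain ⟨hf, hU⟩ := (mdifferentiableAt_totalSpace ..).1 hU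
  have hF' := mdifferentiableAt_frameDeriv hF (f p)
  rw [mvfderiv_congr (mvfderiv_along_eq_frameDeriv F hf.continuousAt)]
  refine (mvfderiv_clm_apply (hF'.comp p hf) hU v).trans ?_
  rw [trivializationAt_snd_self]
  exact congrArg₂ (· + ·) congr($(mvfderiv_mfderiv_comp hF' hf v) _) (frameDeriv_self F (f p) _)

end along

theorem mdifferentiableAt_mvfderiv_field (hF : CMDiff ∞ F) (hY : MDiffAt (T% Y) x) :
    MDiffAt (fun y ↦ mvfderiv I F y (Y y)) x :=
  mdifferentiableAt_mvfderiv_along (f := id) hF hY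

theorem mvfderiv_mvfderiv_field (hF : CMDiff ∞ F) (hY : MDiffAt (T% Y) x) (v : TangentSpace I x) :
    mvfderiv I (fun y ↦ mvfderiv I F y (Y y)) x v =
      mvfderiv I (frameDeriv I F x) x v (Y x) + mvfderiv I F x (mvfderiv I (coord x Y) x v) := by
  have h := mvfderiv_mvfderiv_along (f := id) hF hY v
  rwa [mfderiv_id] at h

theorem mvfderiv_mvfderiv_extend (hF : CMDiff ∞ F) (v w : TangentSpace I x) :
    mvfderiv I (fun y ↦ mvfderiv I F y (FiberBundle.extend E w y)) x v =
      mvfderiv I (frameDeriv I F x) x v w := by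
  have hw : mvfderiv I (coord x (FiberBundle.extend E w)) x v = 0 := by
    rw [mvfderiv_congr (coord_extend x w), mvfderiv_const]
    rfl
  have h := mvfderiv_mvfderiv_field hF (FiberBundle.mdifferentiableAt_extend I E w) v
  rw [hw, FiberBundle.extend_apply_self] at h
  exact h.trans ((congrArg _ (mvfderiv I F x).map_zero).trans (add_zero _))

theorem contMDiff_mvfderiv_field (hF : CMDiff ∞ F) (hY : IsSmoothField I Y) :
    CMDiff ∞ (fun y ↦ mvfderiv I F y (Y y)) := fun x ↦
  ((contMDiffAt_frameDeriv hF x).clm_apply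
    (contMDiffAt_totalSpace.1 (hY x)).2).congr_of_eventuallyEq
      (mvfderiv_along_eq_frameDeriv (f := id) F continuousAt_id)

theorem IsSmoothField.mdifferentiableAt (hY : IsSmoothField I Y) (x : M) : MDiffAt (T% Y) x :=
  (hY x).mdifferentiableAt (by simp)

theorem mvfderiv_mlieBracket [I.Boundaryless] (hF : CMDiff ∞ F) (hX : MDiffAt (T% X) x)
    (hY : MDiffAt (T% Y) x) :
    mvfderiv I F x (VectorField.mlieBracket I X Y x) =
      mvfderiv I (fun y ↦ mvfderiv I F y (Y y)) x (X x) -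
        mvfderiv I (fun y ↦ mvfderiv I F y (X y)) x (Y x) := by
  rw [mvfderiv_mvfderiv_field hF hY, mvfderiv_mvfderiv_field hF hX, ← coord_bracket x X Y hX hY,
    mvfderiv_frameDeriv_symm hF x (X x) (Y x)]
  refine (map_sub (mvfderiv I F x) _ _).trans ?_
  abel

section metric

/-- The metric `g` at `q`, read in the coordinate frame centred at `x`. -/
def Metric.frameForm (g : Metric I M) (x q : M) : E →L[ℝ] E →L[ℝ] ℝ :=
  ContinuousLinearMap.inCoordinates E (TangentSpace I : M → Type _) (E →L[ℝ] ℝ)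
    (fun y : M ↦ TangentSpace I y →L[ℝ] ℝ) x q x q (g.val q)

theorem Metric.mdifferentiableAt_frameForm (g : Metric I M) (x : M) :
    MDiffAt (g.frameForm x) x :=
  ((mdifferentiableAt_hom_bundle _).1 ((g.contMDiff x).mdifferentiableAt (by simp))).2

theorem Metric.frameForm_apply (g : Metric I M) {q : M}
    (hq : q ∈ (trivializationAt E (TangentSpace I : M → Type _) x).baseSet) (u v : E) :
    g.frameForm x q u v = g.val q ((trivializationAt E (TangentSpace I : M → Type _) x).symm q u)
      ((trivializationAt E (TangentSpace I : M → Type _) x).symm q v) := by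
  simpa [frameForm] using inCoordinates_apply_eq₂ (E₃ := Bundle.Trivial M ℝ) (F₃ := ℝ)
    (ϕ := g.val q) (v := u) (w := v) hq hq (Set.mem_univ _)

theorem Metric.isInvertible_frameForm [FiniteDimensional ℝ E] (g : Metric I M) (x : M) :
    (g.frameForm x x).IsInvertible := by
  have hinj : Function.Injective (g.frameForm x x : E →ₗ[ℝ] E →L[ℝ] ℝ) := by
    rw [← LinearMap.ker_eq_bot, LinearMap.ker_eq_bot']
    refine fun u hu ↦ g.nondegenerate x u fun (w : E) ↦ ?_
    have h := g.frameForm_apply (FiberBundle.mem_baseSet_trivializationAt' x) u w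
    rw [trivializationAt_symm_self, trivializationAt_symm_self] at h
    exact h.symm.trans congr($hu w)
  have hdim : Module.finrank ℝ E = Module.finrank ℝ (E →L[ℝ] ℝ) := by
    rw [← Subspace.dual_finrank_eq (K := ℝ) (V := E)]
    exact (LinearMap.toContinuousLinearMap (𝕜 := ℝ) (E := E) (F' := ℝ)).finrank_eq
  have : CompleteSpace E := FiniteDimensional.complete ℝ E
  exact ⟨(LinearMap.linearEquivOfInjective _ hinj hdim).toContinuousLinearEquiv, rfl⟩

theorem Metric.mdifferentiableAt_of_val [FiniteDimensional ℝ E] (g : Metric I M)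
    (h : ∀ w : TangentSpace I x, MDiffAt (fun y ↦ g.val y (Y y) (FiberBundle.extend E w y)) x) :
    MDiffAt (T% Y) x := by
  have hcoord (w : E) : MDiffAt (fun y ↦ g.frameForm x y (coord x Y y) w) x := by
    refine (h w).congr_of_eventuallyEq ?_
    filter_upwards [eventually_mem_baseSet (I := I) x] with y hy
    rw [g.frameForm_apply hy, coord, Trivialization.symm_apply_apply_mk _ hy]
    exact congrArg (fun e ↦ g.val y (Y y)
      ((trivializationAt E (TangentSpace I : M → Type _) x).symm y e))
      (trivializationAt_snd_self x w).symm
  have : CompleteSpace E := FiniteDimensional.complete ℝ E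
  rw [mdifferentiableAt_section]
  exact mdifferentiableAt_of_clm_apply (g.mdifferentiableAt_frameForm x)
    (g.isInvertible_frameForm x) (mdifferentiableAt_of_forall_apply hcoord)

end metric

end frames

section immersion

variable {E : Type*} [NormedAddCommGroup E] [NormedSpace ℝ E]
  {H : Type*} [TopologicalSpace H] {I : ModelWithCorners ℝ E H}
  {M : Type*} [TopologicalSpace M] [ChartedSpace H M] [IsManifold I ∞ M]
  {E₂ : Type*} [NormedAddCommGroup E₂] [NormedSpace ℝ E₂]
  {H₂ : Type*} [TopologicalSpace H₂] {I₂ : ModelWithCorners ℝ E₂ H₂}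
  {M₂ : Type*} [TopologicalSpace M₂] [ChartedSpace H₂ M₂] [IsManifold I₂ ∞ M₂]
  {f : M → M₂} {x : M}

theorem mdifferentiableAt_mfderiv_field (hf : ContMDiff I I₂ ∞ f) {Y : Π y : M, TangentSpace I y}
    (hY : MDiffAt (T% Y) x) : MDifferentiableAt I I₂.tangent
      (fun y ↦ (⟨f y, mfderiv I I₂ f y (Y y)⟩ : TangentBundle I₂ M₂)) x :=
  ((hf.contMDiff_tangentMap (m := ∞) (by simp) ⟨x, Y x⟩).mdifferentiableAt (by simp)).comp x hY

theorem tangentialPart_eq [FiniteDimensional ℝ E] {g : Metric I M} {g₂ : Metric I₂ M₂}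
    {w : TangentSpace I₂ (f x)} {v : TangentSpace I x}
    (h : ∀ u, g.val x v u = g₂.val (f x) w (mfderiv I I₂ f x u)) :
    tangentialPart g g₂ f x w = v := by
  refine sub_eq_zero.1 (g.nondegenerate x _ fun u ↦ ?_)
  rw [map_sub, sub_apply, h, tangentialPart, g.val_sharp]
  exact sub_self _

end immersion

/-- The vector field `dΦ(Y)` along the map `Φ` to a vector space. -/
abbrev pushforward {E : Type*} [NormedAddCommGroup E] [NormedSpace ℝ E]
    {H : Type*} [TopologicalSpace H] {I : ModelWithCorners ℝ E H}
    {M : Type*} [TopologicalSpace M] [ChartedSpace H M]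
    {V : Type*} [NormedAddCommGroup V] [NormedSpace ℝ V]
    (Φ : M → V) (Y : Π y : M, TangentSpace I y) (x : M) : V :=
  mvfderiv I Φ x (Y x)

/-- A semi-Riemannian geometry on a hypersurface `carrier` of a vector space `P`, presented by data
on `P`: a field of scalar products, the Christoffel symbols of a torsion-free connection, and a
field of covectors whose kernels are the tangent spaces of the hypersurface. The connection is
required to preserve the tangent spaces, and to be compatible with the metric, only in tangential
directions. -/
structure HypersurfaceGeometry (P : Type*) [NormedAddCommGroup P] [NormedSpace ℝ P] where
  /-- The points of the hypersurface. -/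
  carrier : Set P
  /-- The scalar product at a point. -/
  metric : P → P →L[ℝ] P →L[ℝ] ℝ
  /-- The Christoffel symbol `Γ_p(u, v)`, so that `∇_u σ = dσ(u) + Γ(u, σ)`. -/
  christoffel : P → P →L[ℝ] P →L[ℝ] P
  /-- A covector that vanishes on the tangent space. -/
  conormal : P → P →L[ℝ] ℝ
  metric_symm (p u v : P) : metric p u v = metric p v u
  christoffel_symm (p u v : P) : christoffel p u v = christoffel p v u
  differentiableAt_metric {p : P} : p ∈ carrier → DifferentiableAt ℝ metric p
  differentiableAt_christoffel {p : P} : p ∈ carrier → DifferentiableAt ℝ christoffel p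
  differentiableAt_conormal {p : P} : p ∈ carrier → DifferentiableAt ℝ conormal p
  fderiv_metric {p u y z : P} : p ∈ carrier → conormal p u = 0 → conormal p y = 0 →
    conormal p z = 0 → fderiv ℝ metric p u y z =
      metric p (christoffel p u y) z + metric p y (christoffel p u z)
  fderiv_conormal {p u y : P} : p ∈ carrier → conormal p u = 0 → conormal p y = 0 →
    fderiv ℝ conormal p u y = conormal p (christoffel p u y)

namespace HypersurfaceGeometry

variable {P : Type*} [NormedAddCommGroup P] [NormedSpace ℝ P]
  {E : Type*} [NormedAddCommGroup E] [NormedSpace ℝ E]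
  {H : Type*} [TopologicalSpace H] {I : ModelWithCorners ℝ E H}
  {M : Type*} [TopologicalSpace M] [ChartedSpace H M]

/-- The curvature operator `R(u, v) y` of the connection with the given Christoffel symbols. -/
def curvatureAt (G : HypersurfaceGeometry P) (p u v y : P) : P :=
  fderiv ℝ G.christoffel p u v y - fderiv ℝ G.christoffel p v u y +
    G.christoffel p u (G.christoffel p v y) - G.christoffel p v (G.christoffel p u y)

/-- The covariant derivative `∇_v σ` of a field `σ` along the map `Φ`. -/
def covDeriv (G : HypersurfaceGeometry P) (Φ σ : M → P) (x : M) (v : TangentSpace I x) : P :=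
  mvfderiv I σ x v + G.christoffel (Φ x) (mvfderiv I Φ x v) (σ x)

/-- `Φ` is a smooth map into the hypersurface. -/
structure IsTangentMap (G : HypersurfaceGeometry P) (I : ModelWithCorners ℝ E H) (Φ : M → P) :
    Prop where
  contMDiff : CMDiff ∞ Φ
  mem (x : M) : Φ x ∈ G.carrier
  conormal_mvfderiv (x : M) (v : TangentSpace I x) : G.conormal (Φ x) (mvfderiv I Φ x v) = 0

/-- The metric that `G` induces along `Φ` is `g`. -/
def Induces [IsManifold I ∞ M] (G : HypersurfaceGeometry P) (Φ : M → P) (g : Metric I M) : Prop :=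
  ∀ (x : M) (u v : TangentSpace I x),
    g.val x u v = G.metric (Φ x) (mvfderiv I Φ x u) (mvfderiv I Φ x v)

/-- The second fundamental form of `Φ` with respect to the connection `C` on `M`, that is, the
difference `∇_v dΦ(Y) - dΦ(C_v Y)`. -/
def secondForm [IsManifold I ∞ M] (G : HypersurfaceGeometry P)
    (C : CovariantDerivative I E (TangentSpace I : M → Type _)) (Φ : M → P)
    (Y : Π y : M, TangentSpace I y) (x : M) (v : TangentSpace I x) : P :=
  G.covDeriv Φ (pushforward Φ Y) x v - mvfderiv I Φ x (C Y x v)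

variable {G : HypersurfaceGeometry P} {Φ σ τ : M → P} {x : M}

namespace IsTangentMap

theorem mdifferentiableAt (hΦ : G.IsTangentMap I Φ) (x : M) : MDiffAt Φ x :=
  (hΦ.contMDiff x).mdifferentiableAt (by simp)

theorem mdifferentiableAt_metric (hΦ : G.IsTangentMap I Φ) (x : M) :
    MDiffAt (fun y ↦ G.metric (Φ y)) x :=
  mdifferentiableAt_comp_of_differentiableAt (G.differentiableAt_metric (hΦ.mem x))
    (hΦ.mdifferentiableAt x)

theorem mdifferentiableAt_christoffel (hΦ : G.IsTangentMap I Φ) (x : M) :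
    MDiffAt (fun y ↦ G.christoffel (Φ y)) x :=
  mdifferentiableAt_comp_of_differentiableAt (G.differentiableAt_christoffel (hΦ.mem x))
    (hΦ.mdifferentiableAt x)

theorem mvfderiv_metric (hΦ : G.IsTangentMap I Φ) (hσ : MDiffAt σ x) (hτ : MDiffAt τ x)
    (hσ₀ : G.conormal (Φ x) (σ x) = 0) (hτ₀ : G.conormal (Φ x) (τ x) = 0)
    (v : TangentSpace I x) :
    mvfderiv I (fun y ↦ G.metric (Φ y) (σ y) (τ y)) x v =
      G.metric (Φ x) (G.covDeriv Φ σ x v) (τ x) + G.metric (Φ x) (σ x) (G.covDeriv Φ τ x v) := by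
  rw [mvfderiv_comp_clm_apply₂ (G.differentiableAt_metric (hΦ.mem x)) (hΦ.mdifferentiableAt x)
      hσ hτ,
    G.fderiv_metric (hΦ.mem x) (hΦ.conormal_mvfderiv x v) hσ₀ hτ₀]
  simp only [covDeriv, map_add, add_apply]
  ring

theorem conormal_covDeriv (hΦ : G.IsTangentMap I Φ) (hσ : MDiffAt σ x)
    (hσ₀ : ∀ y, G.conormal (Φ y) (σ y) = 0) (v : TangentSpace I x) :
    G.conormal (Φ x) (G.covDeriv Φ σ x v) = 0 := by
  have hν := G.differentiableAt_conormal (hΦ.mem x)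
  have h := mvfderiv_clm_apply
    (mdifferentiableAt_comp_of_differentiableAt hν (hΦ.mdifferentiableAt x)) hσ v
  have h₀ : mvfderiv I (fun y ↦ G.conormal (Φ y) (σ y)) x v = 0 := by
    simp only [hσ₀, mvfderiv_const, zero_apply]
  rw [h₀] at h
  rw [covDeriv, map_add, ← G.fderiv_conormal (hΦ.mem x) (hΦ.conormal_mvfderiv x v) (hσ₀ x),
    ← mvfderiv_fderiv_comp hν (hΦ.mdifferentiableAt x), add_comm]
  exact h.symm

variable [IsManifold I ∞ M] {X Y Z W : Π y : M, TangentSpace I y}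

theorem covDeriv_pushforward_sub [I.Boundaryless] (hΦ : G.IsTangentMap I Φ)
    (hX : MDiffAt (T% X) x) (hY : MDiffAt (T% Y) x) :
    G.covDeriv Φ (pushforward Φ Y) x (X x) - G.covDeriv Φ (pushforward Φ X) x (Y x) =
      mvfderiv I Φ x (VectorField.mlieBracket I X Y x) := by
  rw [mvfderiv_mlieBracket hΦ.contMDiff hX hY, covDeriv, covDeriv, G.christoffel_symm]
  abel

theorem mdifferentiableAt_covDeriv (hΦ : G.IsTangentMap I Φ) (hσ : CMDiff ∞ σ)
    (hY : MDiffAt (T% Y) x) : MDiffAt (fun y ↦ G.covDeriv Φ σ y (Y y)) x :=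
  (mdifferentiableAt_mvfderiv_field hσ hY).add
    (((hΦ.mdifferentiableAt_christoffel x).clm_apply
      (mdifferentiableAt_mvfderiv_field hΦ.contMDiff hY)).clm_apply
        ((hσ x).mdifferentiableAt (by simp)))

theorem covDeriv_covDeriv (hΦ : G.IsTangentMap I Φ) (hσ : CMDiff ∞ σ) (hY : MDiffAt (T% Y) x)
    (v : TangentSpace I x) :
    G.covDeriv Φ (fun y ↦ G.covDeriv Φ σ y (Y y)) x v =
      mvfderiv I (pushforward σ Y) x v +
      (fderiv ℝ G.christoffel (Φ x) (mvfderiv I Φ x v) (mvfderiv I Φ x (Y x)) (σ x) +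
        G.christoffel (Φ x) (mvfderiv I (pushforward Φ Y) x v) (σ x) +
        G.christoffel (Φ x) (mvfderiv I Φ x (Y x)) (mvfderiv I σ x v)) +
      G.christoffel (Φ x) (mvfderiv I Φ x v) (G.covDeriv Φ σ x (Y x)) := by
  have hσY : MDiffAt (pushforward σ Y) x := mdifferentiableAt_mvfderiv_field hσ hY
  have hΦY : MDiffAt (pushforward Φ Y) x := mdifferentiableAt_mvfderiv_field hΦ.contMDiff hY
  have hσx : MDiffAt σ x := (hσ x).mdifferentiableAt (by simp)
  have hΓ := ((hΦ.mdifferentiableAt_christoffel x).clm_apply hΦY).clm_apply hσx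
  rw [covDeriv, ← mvfderiv_comp_clm_apply₂ (G.differentiableAt_christoffel (hΦ.mem x))
    (hΦ.mdifferentiableAt x) hΦY hσx]
  exact congr($(mvfderiv_add hσY hΓ) v + _)

theorem covDeriv_commutator [I.Boundaryless] (hΦ : G.IsTangentMap I Φ) (hσ : CMDiff ∞ σ)
    (hX : MDiffAt (T% X) x) (hY : MDiffAt (T% Y) x) :
    G.covDeriv Φ (fun y ↦ G.covDeriv Φ σ y (Y y)) x (X x) -
        G.covDeriv Φ (fun y ↦ G.covDeriv Φ σ y (X y)) x (Y x) -
        G.covDeriv Φ σ x (VectorField.mlieBracket I X Y x) =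
      G.curvatureAt (Φ x) (mvfderiv I Φ x (X x)) (mvfderiv I Φ x (Y x)) (σ x) := by
  rw [hΦ.covDeriv_covDeriv hσ hY, hΦ.covDeriv_covDeriv hσ hX, covDeriv, covDeriv, covDeriv,
    mvfderiv_mlieBracket hσ hX hY, mvfderiv_mlieBracket hΦ.contMDiff hX hY, curvatureAt]
  simp only [map_add, map_sub, sub_apply]
  abel

variable {g : Metric I M} {C : CovariantDerivative I E (TangentSpace I : M → Type _)}

theorem metric_covDeriv_add (hΦ : G.IsTangentMap I Φ) (hg : G.Induces Φ g)
    (hC : IsLeviCivita g C) (hY : MDiffAt (T% Y) x) (hZ : MDiffAt (T% Z) x)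
    (v : TangentSpace I x) :
    G.metric (Φ x) (G.covDeriv Φ (pushforward Φ Y) x v) (mvfderiv I Φ x (Z x)) +
        G.metric (Φ x) (mvfderiv I Φ x (Y x)) (G.covDeriv Φ (pushforward Φ Z) x v) =
      g.val x (C Y x v) (Z x) + g.val x (Y x) (C Z x v) := by
  rw [← hC.metric x Y Z hY hZ v, funext fun y ↦ hg y (Y y) (Z y)]
  exact (hΦ.mvfderiv_metric (mdifferentiableAt_mvfderiv_field hΦ.contMDiff hY)
    (mdifferentiableAt_mvfderiv_field hΦ.contMDiff hZ) (hΦ.conormal_mvfderiv x _)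
    (hΦ.conormal_mvfderiv x _) v).symm

/- `g(∇_X Y, Z) - B(∇_X Y, Z)` is symmetric in `X, Y` and antisymmetric in `Y, Z`, hence zero. -/
theorem val_leviCivita [I.Boundaryless] (hΦ : G.IsTangentMap I Φ) (hg : G.Induces Φ g)
    (hC : IsLeviCivita g C) (hY : MDiffAt (T% Y) x) (v w : TangentSpace I x) :
    g.val x (C Y x v) w =
      G.metric (Φ x) (G.covDeriv Φ (pushforward Φ Y) x v) (mvfderiv I Φ x w) := by
  let D (X Y Z : Π y : M, TangentSpace I y) : ℝ := g.val x (C Y x (X x)) (Z x) -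
    G.metric (Φ x) (G.covDeriv Φ (pushforward Φ Y) x (X x)) (mvfderiv I Φ x (Z x))
  have hsymm {X Y : Π y : M, TangentSpace I y} (hX : MDiffAt (T% X) x) (hY : MDiffAt (T% Y) x)
      (Z : Π y : M, TangentSpace I y) : D X Y Z = D Y X Z := by
    have h₁ := congr(g.val x $(hC.torsion x X Y hX hY) (Z x))
    have h₂ := congr(G.metric (Φ x) $(hΦ.covDeriv_pushforward_sub hX hY)
      (mvfderiv I Φ x (Z x)))
    rw [← hg] at h₂
    simp only [map_sub, sub_apply] at h₁ h₂
    simp only [D]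
    linarith
  have hanti (X : Π y : M, TangentSpace I y) {Y Z : Π y : M, TangentSpace I y}
      (hY : MDiffAt (T% Y) x) (hZ : MDiffAt (T% Z) x) : D X Y Z = -D X Z Y := by
    have h := hΦ.metric_covDeriv_add hg hC hY hZ (X x)
    rw [g.symm x (Y x), G.metric_symm _ (mvfderiv I Φ x (Y x))] at h
    simp only [D]
    linarith
  have hv := FiberBundle.mdifferentiableAt_extend I E v
  have hw := FiberBundle.mdifferentiableAt_extend I E w
  have h : D (FiberBundle.extend E v) Y (FiberBundle.extend E w) = 0 := by
    linarith [hsymm hv hY (FiberBundle.extend E w), hanti Y hv hw,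
      hsymm hY hw (FiberBundle.extend E v), hanti (FiberBundle.extend E w) hY hv,
      hsymm hw hv Y, hanti (FiberBundle.extend E v) hw hY]
  simpa only [D, FiberBundle.extend_apply_self, sub_eq_zero] using h

theorem mdifferentiableAt_leviCivita [I.Boundaryless] [FiniteDimensional ℝ E]
    (hΦ : G.IsTangentMap I Φ) (hg : G.Induces Φ g) (hC : IsLeviCivita g C)
    (hZ : IsSmoothField I Z) (hY : MDiffAt (T% Y) x) :
    MDiffAt (T% (fun y ↦ C Z y (Y y))) x := by
  refine g.mdifferentiableAt_of_val fun w ↦ ?_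
  rw [funext fun y ↦ hΦ.val_leviCivita hg hC (hZ.mdifferentiableAt y) (Y y) _]
  exact ((hΦ.mdifferentiableAt_metric x).clm_apply (hΦ.mdifferentiableAt_covDeriv
    (contMDiff_mvfderiv_field hΦ.contMDiff hZ) hY)).clm_apply
      (mdifferentiableAt_mvfderiv_field hΦ.contMDiff (FiberBundle.mdifferentiableAt_extend I E w))

theorem metric_secondForm [I.Boundaryless] (hΦ : G.IsTangentMap I Φ) (hg : G.Induces Φ g)
    (hC : IsLeviCivita g C) (hY : MDiffAt (T% Y) x) (v w : TangentSpace I x) :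
    G.metric (Φ x) (G.secondForm C Φ Y x v) (mvfderiv I Φ x w) = 0 := by
  rw [secondForm, map_sub, sub_apply, ← hΦ.val_leviCivita hg hC hY, ← hg, sub_self]

theorem metric_secondForm_secondForm [I.Boundaryless] (hΦ : G.IsTangentMap I Φ)
    (hg : G.Induces Φ g) (hC : IsLeviCivita g C) (hY : MDiffAt (T% Y) x)
    (hZ : MDiffAt (T% Z) x) (u v : TangentSpace I x) :
    G.metric (Φ x) (G.secondForm C Φ Y x u) (G.secondForm C Φ Z x v) =
      G.metric (Φ x) (G.covDeriv Φ (pushforward Φ Y) x u) (G.covDeriv Φ (pushforward Φ Z) x v) -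
        g.val x (C Y x u) (C Z x v) := by
  have h := hΦ.metric_secondForm hg hC hZ v (C Y x u)
  rw [G.metric_symm] at h
  calc
    _ = G.metric (Φ x) (G.covDeriv Φ (pushforward Φ Y) x u) (G.secondForm C Φ Z x v) -
        G.metric (Φ x) (mvfderiv I Φ x (C Y x u)) (G.secondForm C Φ Z x v) := by
      rw [← sub_apply, ← map_sub, ← secondForm]
    _ = _ := by rw [h, sub_zero, secondForm, map_sub, ← hΦ.val_leviCivita hg hC hY]

theorem val_leviCivita_leviCivita [I.Boundaryless] [FiniteDimensional ℝ E]
    (hΦ : G.IsTangentMap I Φ) (hg : G.Induces Φ g) (hC : IsLeviCivita g C)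
    (hZ : IsSmoothField I Z) (hY : MDiffAt (T% Y) x) (hW : MDiffAt (T% W) x)
    (v : TangentSpace I x) :
    g.val x (C (fun y ↦ C Z y (Y y)) x v) (W x) =
      G.metric (Φ x) (G.covDeriv Φ (fun y ↦ G.covDeriv Φ (pushforward Φ Z) y (Y y)) x v)
          (mvfderiv I Φ x (W x)) +
        G.metric (Φ x) (G.secondForm C Φ Z x (Y x)) (G.secondForm C Φ W x v) := by
  have hZΦ := contMDiff_mvfderiv_field hΦ.contMDiff hZ
  have hYZ := hΦ.mdifferentiableAt_leviCivita hg hC hZ hY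
  have h₁ := hC.metric x (fun y ↦ C Z y (Y y)) W hYZ hW v
  have h₂ := hΦ.mvfderiv_metric (hΦ.mdifferentiableAt_covDeriv hZΦ hY)
    (mdifferentiableAt_mvfderiv_field hΦ.contMDiff hW)
    (hΦ.conormal_covDeriv (hZΦ.mdifferentiableAt (by simp))
      (fun y ↦ hΦ.conormal_mvfderiv y (Z y)) (Y x)) (hΦ.conormal_mvfderiv x (W x)) v
  rw [funext fun y ↦ hΦ.val_leviCivita hg hC (hZ.mdifferentiableAt y) (Y y) (W y)] at h₁
  rw [hΦ.metric_secondForm_secondForm hg hC (hZ.mdifferentiableAt x) hW]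
  linarith

theorem val_curvature [I.Boundaryless] [FiniteDimensional ℝ E]
    (hΦ : G.IsTangentMap I Φ) (hg : G.Induces Φ g) (hC : IsLeviCivita g C)
    (hX : MDiffAt (T% X) x) (hY : MDiffAt (T% Y) x) (hZ : IsSmoothField I Z)
    (hW : MDiffAt (T% W) x) :
    g.val x (curvature C X Y Z x) (W x) =
      G.metric (Φ x) (G.curvatureAt (Φ x) (mvfderiv I Φ x (X x)) (mvfderiv I Φ x (Y x))
          (mvfderiv I Φ x (Z x))) (mvfderiv I Φ x (W x)) -
        G.metric (Φ x) (G.secondForm C Φ Z x (X x)) (G.secondForm C Φ W x (Y x)) +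
        G.metric (Φ x) (G.secondForm C Φ Z x (Y x)) (G.secondForm C Φ W x (X x)) := by
  rw [← hΦ.covDeriv_commutator (contMDiff_mvfderiv_field hΦ.contMDiff hZ) hX hY, curvature]
  simp only [map_sub, sub_apply]
  rw [hΦ.val_leviCivita_leviCivita hg hC hZ hY hW, hΦ.val_leviCivita_leviCivita hg hC hZ hX hW,
    hΦ.val_leviCivita hg hC (hZ.mdifferentiableAt x)]
  ring

end IsTangentMap

section immersion

variable {E₂ : Type*} [NormedAddCommGroup E₂] [NormedSpace ℝ E₂]
  {H₂ : Type*} [TopologicalSpace H₂] {I₂ : ModelWithCorners ℝ E₂ H₂}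
  {M₂ : Type*} [TopologicalSpace M₂] [ChartedSpace H₂ M₂]
  {Φ₂ : M₂ → P} {f : M → M₂}

theorem IsTangentMap.comp (hΦ₂ : G.IsTangentMap I₂ Φ₂) (hf : ContMDiff I I₂ ∞ f) :
    G.IsTangentMap I (fun x ↦ Φ₂ (f x)) where
  contMDiff := hΦ₂.contMDiff.comp hf
  mem x := hΦ₂.mem (f x)
  conormal_mvfderiv x v := by
    rw [mvfderiv_mfderiv_comp (hΦ₂.mdifferentiableAt (f x)) ((hf x).mdifferentiableAt (by simp))]
    exact hΦ₂.conormal_mvfderiv (f x) _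

variable [IsManifold I ∞ M] [IsManifold I₂ ∞ M₂] {g : Metric I M} {g₂ : Metric I₂ M₂}
  {C₂ : CovariantDerivative I₂ E₂ (TangentSpace I₂ : M₂ → Type _)}
  {X Y Z W : Π y : M, TangentSpace I y}

theorem Induces.comp (hg₂ : G.Induces Φ₂ g₂) (hΦ₂ : G.IsTangentMap I₂ Φ₂)
    (hf : IsIsometricImmersion g g₂ f) : G.Induces (fun x ↦ Φ₂ (f x)) g := fun x u v ↦ by
  have hf' := (hf.contMDiff x).mdifferentiableAt (by simp)
  rw [mvfderiv_mfderiv_comp (hΦ₂.mdifferentiableAt (f x)) hf',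
    mvfderiv_mfderiv_comp (hΦ₂.mdifferentiableAt (f x)) hf', ← hf.isometric, hg₂]

/-- `Φ` is a smooth map into the hypersurface whose differential maps onto the tangent spaces. -/
structure IsSubmersive (G : HypersurfaceGeometry P) (I : ModelWithCorners ℝ E H) (Φ : M → P) : Prop
    extends G.IsTangentMap I Φ where
  exists_mvfderiv_eq (x : M) {w : P} : G.conormal (Φ x) w = 0 → ∃ v, mvfderiv I Φ x v = w

namespace IsSubmersive

theorem mvfderiv_leviCivita [I₂.Boundaryless] (hΦ₂ : G.IsSubmersive I₂ Φ₂) (hg₂ : G.Induces Φ₂ g₂)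
    (hC₂ : IsLeviCivita g₂ C₂) {q : M₂} {Y : Π y : M₂, TangentSpace I₂ y} (hY : MDiffAt (T% Y) q)
    (v : TangentSpace I₂ q) :
    mvfderiv I₂ Φ₂ q (C₂ Y q v) = G.covDeriv Φ₂ (pushforward Φ₂ Y) q v := by
  obtain ⟨u, hu⟩ := hΦ₂.exists_mvfderiv_eq q (hΦ₂.conormal_covDeriv
    (mdifferentiableAt_mvfderiv_field hΦ₂.contMDiff hY)
    (fun y ↦ hΦ₂.conormal_mvfderiv y (Y y)) v)
  suffices C₂ Y q v = u by rw [this, hu]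
  refine sub_eq_zero.1 (g₂.nondegenerate q _ fun w ↦ ?_)
  rw [map_sub, sub_apply, hΦ₂.val_leviCivita hg₂ hC₂ hY, ← hu, ← hg₂, sub_self]

theorem mvfderiv_covDerivAlong [I₂.Boundaryless] (hΦ₂ : G.IsSubmersive I₂ Φ₂)
    (hg₂ : G.Induces Φ₂ g₂) (hC₂ : IsLeviCivita g₂ C₂) {U : Π y : M, TangentSpace I₂ (f y)}
    (hU : MDifferentiableAt I I₂.tangent (fun y ↦ (⟨f y, U y⟩ : TangentBundle I₂ M₂)) x)
    (v : TangentSpace I x) :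
    mvfderiv I₂ Φ₂ (f x) (covDerivAlong I C₂ f U x v) =
      G.covDeriv (fun y ↦ Φ₂ (f y)) (fun y ↦ mvfderiv I₂ Φ₂ (f y) (U y)) x v := by
  have hf := ((mdifferentiableAt_totalSpace ..).1 hU).1
  rw [covDerivAlong, map_add, trivializationAt_symm_self,
    hΦ₂.mvfderiv_leviCivita hg₂ hC₂ (FiberBundle.mdifferentiableAt_extend I₂ E₂ (U x)), covDeriv,
    covDeriv, mvfderiv_mvfderiv_extend hΦ₂.contMDiff, mvfderiv_mvfderiv_along hΦ₂.contMDiff hU,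
    mvfderiv_mfderiv_comp (hΦ₂.mdifferentiableAt (f x)) hf, pushforward,
    FiberBundle.extend_apply_self]
  abel

theorem mvfderiv_covDerivAlong_mfderiv [I₂.Boundaryless] (hΦ₂ : G.IsSubmersive I₂ Φ₂)
    (hg₂ : G.Induces Φ₂ g₂) (hf : ContMDiff I I₂ ∞ f) (hC₂ : IsLeviCivita g₂ C₂)
    (hY : MDiffAt (T% Y) x) (v : TangentSpace I x) :
    mvfderiv I₂ Φ₂ (f x) (covDerivAlong I C₂ f (fun y ↦ mfderiv I I₂ f y (Y y)) x v) =
      G.covDeriv (fun y ↦ Φ₂ (f y)) (pushforward (fun y ↦ Φ₂ (f y)) Y) x v := by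
  rw [hΦ₂.mvfderiv_covDerivAlong hg₂ hC₂ (mdifferentiableAt_mfderiv_field hf hY)]
  congr! 2 with y
  exact (mvfderiv_mfderiv_comp (hΦ₂.mdifferentiableAt (f y))
    ((hf y).mdifferentiableAt (by simp)) (Y y)).symm

variable [FiniteDimensional ℝ E] [I.Boundaryless] [I₂.Boundaryless]

theorem tangentialPart_covDerivAlong (hΦ₂ : G.IsSubmersive I₂ Φ₂) (hg₂ : G.Induces Φ₂ g₂)
    (hf : IsIsometricImmersion g g₂ f) (hC₂ : IsLeviCivita g₂ C₂) (hY : MDiffAt (T% Y) x)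
    (v : TangentSpace I x) :
    tangentialPart g g₂ f x (covDerivAlong I C₂ f (fun y ↦ mfderiv I I₂ f y (Y y)) x v) =
      g.leviCivita Y x v := by
  have hf' := (hf.contMDiff x).mdifferentiableAt (by simp)
  refine tangentialPart_eq fun u ↦ ?_
  rw [(hΦ₂.comp hf.contMDiff).val_leviCivita (hg₂.comp hΦ₂.toIsTangentMap hf)
    g.isLeviCivita_leviCivita hY, hg₂, hΦ₂.mvfderiv_covDerivAlong_mfderiv hg₂ hf.contMDiff hC₂ hY,
    mvfderiv_mfderiv_comp (hΦ₂.mdifferentiableAt (f x)) hf']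

theorem mvfderiv_secondFundamentalForm [FiniteDimensional ℝ E₂] (hΦ₂ : G.IsSubmersive I₂ Φ₂)
    (hg₂ : G.Induces Φ₂ g₂) (hf : IsIsometricImmersion g g₂ f) (hY : MDiffAt (T% Y) x) :
    mvfderiv I₂ Φ₂ (f x) (secondFundamentalForm g g₂ f X Y x) =
      G.secondForm g.leviCivita (fun y ↦ Φ₂ (f y)) Y x (X x) := by
  have hf' := (hf.contMDiff x).mdifferentiableAt (by simp)
  have hC₂ := g₂.isLeviCivita_leviCivita
  rw [secondFundamentalForm, normalPart, hΦ₂.tangentialPart_covDerivAlong hg₂ hf hC₂ hY, map_sub,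
    hΦ₂.mvfderiv_covDerivAlong_mfderiv hg₂ hf.contMDiff hC₂ hY, secondForm,
    mvfderiv_mfderiv_comp (hΦ₂.mdifferentiableAt (f x)) hf']

theorem curvatureTensor_eq [FiniteDimensional ℝ E₂] (hΦ₂ : G.IsSubmersive I₂ Φ₂)
    (hg₂ : G.Induces Φ₂ g₂) (hf : IsIsometricImmersion g g₂ f) (hX : MDiffAt (T% X) x)
    (hY : MDiffAt (T% Y) x) (hZ : IsSmoothField I Z) (hW : MDiffAt (T% W) x) :
    g.curvatureTensor X Y Z W x =
      G.metric (Φ₂ (f x)) (G.curvatureAt (Φ₂ (f x)) (mvfderiv I (fun y ↦ Φ₂ (f y)) x (X x))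
        (mvfderiv I (fun y ↦ Φ₂ (f y)) x (Y x)) (mvfderiv I (fun y ↦ Φ₂ (f y)) x (Z x)))
          (mvfderiv I (fun y ↦ Φ₂ (f y)) x (W x)) -
        g₂.val (f x) (secondFundamentalForm g g₂ f X Z x) (secondFundamentalForm g g₂ f Y W x) +
        g₂.val (f x) (secondFundamentalForm g g₂ f Y Z x)
          (secondFundamentalForm g g₂ f X W x) := by
  have hZx := hZ.mdifferentiableAt x
  rw [hg₂, hg₂, hΦ₂.mvfderiv_secondFundamentalForm hg₂ hf hZx,
    hΦ₂.mvfderiv_secondFundamentalForm hg₂ hf hZx, hΦ₂.mvfderiv_secondFundamentalForm hg₂ hf hW,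
    hΦ₂.mvfderiv_secondFundamentalForm hg₂ hf hW, Metric.curvatureTensor]
  exact (hΦ₂.comp hf.contMDiff).val_curvature (hg₂.comp hΦ₂.toIsTangentMap hf)
    g.isLeviCivita_leviCivita hX hY hZ hW

end IsSubmersive

end immersion

end HypersurfaceGeometry

section

variable {P Q K W : Type*} [NormedAddCommGroup P] [NormedSpace ℝ P] [NormedAddCommGroup Q]
  [NormedSpace ℝ Q] [NormedAddCommGroup K] [NormedSpace ℝ K] [NormedAddCommGroup W]
  [NormedSpace ℝ W] {k : P → K} {k' : P →L[ℝ] K} {p : P}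

/-- The bilinear map `(u, v) ↦ B(u, v) • w`, as a linear function of `w`. -/
def formSmul (B : P →L[ℝ] P →L[ℝ] ℝ) : Q →L[ℝ] P →L[ℝ] P →L[ℝ] Q :=
  (ContinuousLinearMap.compL ℝ P (P →L[ℝ] ℝ) (P →L[ℝ] Q)).flip B ∘L
    (ContinuousLinearMap.smulRightL ℝ P Q).flip

theorem hasFDerivAt_clm_comp (L : K →L[ℝ] W) (hk : HasFDerivAt k k' p) :
    HasFDerivAt (fun x ↦ L (k x)) (L ∘L k') p :=
  L.hasFDerivAt.comp p hk

theorem fderiv_clm_comp (L : K →L[ℝ] W) (hk : HasFDerivAt k k' p) (w : P) :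
    fderiv ℝ (fun x ↦ L (k x)) p w = L (k' w) :=
  congr($((hasFDerivAt_clm_comp L hk).fderiv) w)

set_option synthInstance.maxHeartbeats 200000 in
-- Instance search is slow on the nested spaces of operators.
theorem differentiableAt_clm_comp₂ (L : K →L[ℝ] P →L[ℝ] P →L[ℝ] Q) (hk : HasFDerivAt k k' p) :
    DifferentiableAt ℝ (fun x ↦ L (k x)) p :=
  (hasFDerivAt_clm_comp (W := P →L[ℝ] P →L[ℝ] Q) L hk).differentiableAt

set_option synthInstance.maxHeartbeats 200000 in
-- Instance search is slow on the nested spaces of operators.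
theorem fderiv_clm_comp₂ (L : K →L[ℝ] P →L[ℝ] P →L[ℝ] Q) (hk : HasFDerivAt k k' p) (w u v : P) :
    fderiv ℝ (fun x ↦ L (k x)) p w u v = L (k' w) u v :=
  congr($(fderiv_clm_comp (W := P →L[ℝ] P →L[ℝ] Q) L hk w) u v)

end

/-- The data of a warped product of an open set of the line and the quadric `form p p = c` of a
vector space `V`, with the metric `ε dt² + a(t)² form`. -/
structure WarpedQuadric (V : Type*) [NormedAddCommGroup V] [NormedSpace ℝ V] where
  ε : ℝ
  c : ℝ
  form : V →L[ℝ] V →L[ℝ] ℝ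
  base : Set ℝ
  a : ℝ → ℝ
  ε_ne_zero : ε ≠ 0
  c_ne_zero : c ≠ 0
  form_symm (u v : V) : form u v = form v u
  isOpen_base : IsOpen base
  contDiffOn : ContDiffOn ℝ ∞ a base
  ne_zero {t : ℝ} : t ∈ base → a t ≠ 0

namespace WarpedQuadric

variable {V : Type*} [NormedAddCommGroup V] [NormedSpace ℝ V] (D : WarpedQuadric V) {p : ℝ × V}
  {t : ℝ}

theorem hasDerivAt_a (ht : t ∈ D.base) : HasDerivAt D.a (deriv D.a t) t :=
  ((D.contDiffOn.contDiffAt (D.isOpen_base.mem_nhds ht)).differentiableAt (by simp)).hasDerivAt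

theorem hasDerivAt_deriv_a (ht : t ∈ D.base) :
    HasDerivAt (deriv D.a) (deriv (deriv D.a) t) t :=
  ((D.contDiffOn.contDiffAt (D.isOpen_base.mem_nhds ht)).derivWithin (m := ∞) (by simp)
    |>.differentiableAt (by simp)).hasDerivAt

/-- The bilinear form `form` on the second components. -/
def fibreForm : (ℝ × V) →L[ℝ] (ℝ × V) →L[ℝ] ℝ :=
  D.form.bilinearComp (.snd ℝ ℝ V) (.snd ℝ ℝ V)

/-- The bilinear form `dt²`. -/
def baseForm (V : Type*) [NormedAddCommGroup V] [NormedSpace ℝ V] :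
    (ℝ × V) →L[ℝ] (ℝ × V) →L[ℝ] ℝ :=
  (ContinuousLinearMap.mul ℝ ℝ).bilinearComp (.fst ℝ ℝ V) (.fst ℝ ℝ V)

/-- The bilinear map `(u, v) ↦ (0, u₁ v₂ + v₁ u₂)`. -/
def mixed (V : Type*) [NormedAddCommGroup V] [NormedSpace ℝ V] :
    (ℝ × V) →L[ℝ] (ℝ × V) →L[ℝ] ℝ × V :=
  let S := (ContinuousLinearMap.lsmul ℝ ℝ).bilinearComp (.fst ℝ ℝ V) (.inr ℝ ℝ V ∘L .snd ℝ ℝ V)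
  S + S.flip

/-- The scalar product `r dt² + s form`, as a linear function of `(r, s)`. -/
def metricOfCoeff : (ℝ × ℝ) →L[ℝ] (ℝ × V) →L[ℝ] (ℝ × V) →L[ℝ] ℝ :=
  formSmul (baseForm V) ∘L .fst ℝ ℝ ℝ + formSmul D.fibreForm ∘L .snd ℝ ℝ ℝ

/-- The scalar product `ε dt² + a(t)² form` at `p`. -/
def metric (p : ℝ × V) : (ℝ × V) →L[ℝ] (ℝ × V) →L[ℝ] ℝ :=
  D.metricOfCoeff (D.ε, D.a p.1 ^ 2)

/-- The bilinear map `(u, v) ↦ form(u₂, v₂) • w + s • (0, u₁ v₂ + v₁ u₂)`, as a linear function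
of `(w, s)`. -/
def christoffelOfCoeff : ((ℝ × V) × ℝ) →L[ℝ] (ℝ × V) →L[ℝ] (ℝ × V) →L[ℝ] ℝ × V :=
  formSmul D.fibreForm ∘L .fst ℝ (ℝ × V) ℝ +
    ContinuousLinearMap.toSpanSingleton ℝ (mixed V) ∘L .snd ℝ (ℝ × V) ℝ

/-- The Christoffel symbols of the warped product at `p`. -/
def christoffel (p : ℝ × V) : (ℝ × V) →L[ℝ] (ℝ × V) →L[ℝ] ℝ × V :=
  D.christoffelOfCoeff
    ((-(D.ε⁻¹ * (D.a p.1 * deriv D.a p.1)), D.c⁻¹ • p.2), deriv D.a p.1 / D.a p.1)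

theorem fibreForm_apply (u v : ℝ × V) : D.fibreForm u v = D.form u.2 v.2 := rfl

theorem metricOfCoeff_apply (r s : ℝ) (u v : ℝ × V) :
    D.metricOfCoeff (r, s) u v = r * (u.1 * v.1) + s * D.form u.2 v.2 := by
  change u.1 * v.1 * r + D.form u.2 v.2 * s = _
  ring

theorem mixed_apply (u v : ℝ × V) : mixed V u v = (0, u.1 • v.2 + v.1 • u.2) := by
  simp [mixed]

theorem christoffelOfCoeff_apply (r s : ℝ) (w : V) (u v : ℝ × V) :
    D.christoffelOfCoeff ((r, w), s) u v =
      (r * D.form u.2 v.2, s • (u.1 • v.2 + v.1 • u.2) + D.form u.2 v.2 • w) := by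
  change D.form u.2 v.2 • (r, w) + s • mixed V u v = _
  rw [mixed_apply]
  ext
  · simp [mul_comm]
  · simp [add_comm]

theorem metric_apply (p u v : ℝ × V) :
    D.metric p u v = D.ε * (u.1 * v.1) + D.a p.1 ^ 2 * D.form u.2 v.2 :=
  D.metricOfCoeff_apply ..

theorem christoffel_apply (p u v : ℝ × V) : D.christoffel p u v =
    (-(D.ε⁻¹ * (D.a p.1 * deriv D.a p.1)) * D.form u.2 v.2,
      (deriv D.a p.1 / D.a p.1) • (u.1 • v.2 + v.1 • u.2) + D.form u.2 v.2 • D.c⁻¹ • p.2) :=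
  D.christoffelOfCoeff_apply ..

theorem hasFDerivAt_metric_coeff (hp : p.1 ∈ D.base) :
    HasFDerivAt (fun x : ℝ × V ↦ (D.ε, D.a x.1 ^ 2))
      (.prod 0 ((2 * D.a p.1 * deriv D.a p.1) • .fst ℝ ℝ V)) p := by
  have h := ((D.hasDerivAt_a hp).pow 2).comp_hasFDerivAt p
    (hasFDerivAt_fst : HasFDerivAt Prod.fst (.fst ℝ ℝ V) p)
  simp only [Nat.cast_ofNat, Nat.add_one_sub_one, pow_one] at h
  exact (hasFDerivAt_const D.ε p).prodMk h

theorem hasFDerivAt_christoffel_coeff (hp : p.1 ∈ D.base) :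
    HasFDerivAt (fun x : ℝ × V ↦
        ((-(D.ε⁻¹ * (D.a x.1 * deriv D.a x.1)), D.c⁻¹ • x.2), deriv D.a x.1 / D.a x.1))
      (.prod (.prod (-(D.ε⁻¹ • (deriv D.a p.1 ^ 2 + D.a p.1 * deriv (deriv D.a) p.1) •
          .fst ℝ ℝ V)) (D.c⁻¹ • .snd ℝ ℝ V))
        ((deriv (deriv D.a) p.1 / D.a p.1 - deriv D.a p.1 ^ 2 / D.a p.1 ^ 2) • .fst ℝ ℝ V)) p := by
  have ha := D.hasDerivAt_a hp
  have ha' := D.hasDerivAt_deriv_a hp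
  have hfst : HasFDerivAt Prod.fst (.fst ℝ ℝ V) p := hasFDerivAt_fst
  have h₁ := (((ha.mul ha').comp_hasFDerivAt p hfst).const_smul D.ε⁻¹).neg.prodMk
    (hasFDerivAt_snd.const_smul D.c⁻¹)
  have h₂ := (ha'.div ha (D.ne_zero hp)).comp_hasFDerivAt p hfst
  rw [← sq] at h₁
  rw [← sq, sub_div, sq (D.a p.1), mul_div_mul_right _ _ (D.ne_zero hp), ← sq] at h₂
  exact h₁.prodMk h₂

theorem fderiv_metric_apply (hp : p.1 ∈ D.base) (w u v : ℝ × V) :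
    fderiv ℝ D.metric p w u v = 2 * D.a p.1 * deriv D.a p.1 * w.1 * D.form u.2 v.2 :=
  (fderiv_clm_comp₂ _ (D.hasFDerivAt_metric_coeff hp) w u v).trans <| by
    simp [metricOfCoeff_apply]

theorem fderiv_christoffel_apply (hp : p.1 ∈ D.base) (w u v : ℝ × V) :
    fderiv ℝ D.christoffel p w u v =
      (-(D.ε⁻¹ * ((deriv D.a p.1 ^ 2 + D.a p.1 * deriv (deriv D.a) p.1) * w.1)) * D.form u.2 v.2,
        ((deriv (deriv D.a) p.1 / D.a p.1 - deriv D.a p.1 ^ 2 / D.a p.1 ^ 2) * w.1) •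
          (u.1 • v.2 + v.1 • u.2) + D.form u.2 v.2 • D.c⁻¹ • w.2) :=
  (fderiv_clm_comp₂ _ (D.hasFDerivAt_christoffel_coeff hp) w u v).trans
    (D.christoffelOfCoeff_apply ..)

/-- The warped product of the base and the quadric, as a hypersurface of `ℝ × V`. -/
def geometry : HypersurfaceGeometry (ℝ × V) where
  carrier := {p | p.1 ∈ D.base ∧ D.form p.2 p.2 = D.c}
  metric := D.metric
  christoffel := D.christoffel
  conormal := D.fibreForm
  metric_symm p u v := by
    rw [metric_apply, metric_apply, mul_comm u.1, D.form_symm]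
  christoffel_symm p u v := by
    rw [christoffel_apply, christoffel_apply, D.form_symm, add_comm (u.1 • v.2)]
  differentiableAt_metric hp := differentiableAt_clm_comp₂ _ (D.hasFDerivAt_metric_coeff hp.1)
  differentiableAt_christoffel hp :=
    differentiableAt_clm_comp₂ _ (D.hasFDerivAt_christoffel_coeff hp.1)
  differentiableAt_conormal _ := D.fibreForm.differentiableAt
  fderiv_metric {p u y z} hp _ hy hz := by
    have ha := D.ne_zero hp.1
    have hε := D.ε_ne_zero
    rw [fibreForm_apply] at hy hz
    simp only [D.fderiv_metric_apply hp.1, metric_apply, christoffel_apply, map_add, map_smul,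
      add_apply, smul_apply, smul_eq_mul, D.form_symm _ p.2, hy, hz]
    rw [D.form_symm u.2 y.2]
    field_simp
    ring
  fderiv_conormal {p u y} hp hu hy := by
    rw [fibreForm_apply] at hu hy
    simp only [ContinuousLinearMap.fderiv, fibreForm_apply, christoffel_apply, map_add, map_smul,
      hu, hy, hp.2, smul_eq_mul]
    field_simp [D.c_ne_zero]
    simp

theorem metric_curvatureAt {p u v y z : ℝ × V} (hp : p.1 ∈ D.base)
    (hu : D.fibreForm p u = 0) (hv : D.fibreForm p v = 0) (hz : D.fibreForm p z = 0) :
    D.metric p (D.geometry.curvatureAt p u v y) z =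
      (D.ε⁻¹ * deriv D.a p.1 ^ 2 / D.a p.1 ^ 2 - D.c⁻¹ / D.a p.1 ^ 2) *
          (D.metric p u y * D.metric p v z - D.metric p v y * D.metric p u z) +
        (deriv (deriv D.a) p.1 / D.a p.1 - deriv D.a p.1 ^ 2 / D.a p.1 ^ 2 +
            D.ε * D.c⁻¹ / D.a p.1 ^ 2) *
          (D.metric p u y * (v.1 * z.1) - D.metric p v y * (u.1 * z.1) -
            D.metric p u z * (v.1 * y.1) + D.metric p v z * (u.1 * y.1)) := by
  have ha := D.ne_zero hp
  have hε := D.ε_ne_zero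
  rw [fibreForm_apply] at hu hv hz
  change D.metric p (fderiv ℝ D.christoffel p u v y - fderiv ℝ D.christoffel p v u y +
    D.christoffel p u (D.christoffel p v y) - D.christoffel p v (D.christoffel p u y)) z = _
  simp only [D.fderiv_christoffel_apply hp, metric_apply, christoffel_apply, map_add, map_sub,
    map_smul, add_apply, sub_apply, smul_apply, smul_eq_mul, D.form_symm _ p.2, hu, hv, hz,
    smul_add, D.form_symm v.2 u.2]
  field_simp
  ring

variable {E : Type*} [NormedAddCommGroup E] [NormedSpace ℝ E] [FiniteDimensional ℝ E]
  {H : Type*} [TopologicalSpace H] {I : ModelWithCorners ℝ E H} [I.Boundaryless]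
  {M : Type*} [TopologicalSpace M] [ChartedSpace H M] [IsManifold I ∞ M]
  {E₂ : Type*} [NormedAddCommGroup E₂] [NormedSpace ℝ E₂] [FiniteDimensional ℝ E₂]
  {H₂ : Type*} [TopologicalSpace H₂] {I₂ : ModelWithCorners ℝ E₂ H₂} [I₂.Boundaryless]
  {M₂ : Type*} [TopologicalSpace M₂] [ChartedSpace H₂ M₂] [IsManifold I₂ ∞ M₂]
  {g : Metric I M} {g₂ : Metric I₂ M₂} {f : M → M₂} {Φ₂ : M₂ → ℝ × V}
  {X Y Z W : Π x : M, TangentSpace I x} {x : M}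

theorem curvatureTensor_eq (hΦ₂ : D.geometry.IsSubmersive I₂ Φ₂) (hg₂ : D.geometry.Induces Φ₂ g₂)
    (hf : IsIsometricImmersion g g₂ f) (hX : MDiffAt (T% X) x) (hY : MDiffAt (T% Y) x)
    (hZ : IsSmoothField I Z) (hW : MDiffAt (T% W) x) :
    let τ : M → ℝ := fun y ↦ (Φ₂ (f y)).1
    let b := D.a (τ x)
    let b' := deriv D.a (τ x)
    let b'' := deriv (deriv D.a) (τ x)
    let α := secondFundamentalForm g g₂ f
    g.curvatureTensor X Y Z W x =
      (D.ε⁻¹ * b' ^ 2 / b ^ 2 - D.c⁻¹ / b ^ 2) *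
          (g.val x (X x) (Z x) * g.val x (Y x) (W x) - g.val x (Y x) (Z x) * g.val x (X x) (W x)) +
        (b'' / b - b' ^ 2 / b ^ 2 + D.ε * D.c⁻¹ / b ^ 2) *
          (g.val x (X x) (Z x) * (mvfderiv I τ x (Y x) * mvfderiv I τ x (W x)) -
            g.val x (Y x) (Z x) * (mvfderiv I τ x (X x) * mvfderiv I τ x (W x)) -
            g.val x (X x) (W x) * (mvfderiv I τ x (Y x) * mvfderiv I τ x (Z x)) +
            g.val x (Y x) (W x) * (mvfderiv I τ x (X x) * mvfderiv I τ x (Z x))) -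
        g₂.val (f x) (α X Z x) (α Y W x) + g₂.val (f x) (α Y Z x) (α X W x) := by
  intro τ b b' b'' α
  have hΦ := hΦ₂.comp hf.contMDiff
  have hval (u v : TangentSpace I x) : D.metric (Φ₂ (f x))
      (mvfderiv I (fun y ↦ Φ₂ (f y)) x u) (mvfderiv I (fun y ↦ Φ₂ (f y)) x v) = g.val x u v :=
    (hg₂.comp hΦ₂.toIsTangentMap hf x u v).symm
  have hτ (v : TangentSpace I x) : (mvfderiv I (fun y ↦ Φ₂ (f y)) x v).1 = mvfderiv I τ x v := by
    rw [mvfderiv_fderiv_comp differentiableAt_fst (hΦ.mdifferentiableAt x), fderiv_fst]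
    rfl
  have hcurv := D.metric_curvatureAt (y := mvfderiv I (fun y ↦ Φ₂ (f y)) x (Z x)) (hΦ.mem x).1
    (hΦ.conormal_mvfderiv x (X x)) (hΦ.conormal_mvfderiv x (Y x)) (hΦ.conormal_mvfderiv x (W x))
  simp only [hval, hτ] at hcurv
  rw [hΦ₂.curvatureTensor_eq hg₂ hf hX hY hZ hW]
  exact congr($hcurv - _ + _)

end WarpedQuadric

theorem Metric.val_smul_gradient {E : Type*} [NormedAddCommGroup E] [NormedSpace ℝ E]
    [FiniteDimensional ℝ E] {H : Type*} [TopologicalSpace H] {I : ModelWithCorners ℝ E H}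
    {M : Type*} [TopologicalSpace M] [ChartedSpace H M] [IsManifold I ∞ M] (g : Metric I M) (r : ℝ)
    (τ : M → ℝ) {x : M} (v : TangentSpace I x) :
    g.val x v (r • g.gradient τ x) = r * mvfderiv I τ x v := by
  rw [map_smul, smul_eq_mul, g.symm, Metric.gradient, Metric.val_sharp]

section warped

variable {N l : ℕ} {ε c : ℤˣ} {J : TopologicalSpace.Opens ℝ} {a : ℝ → ℝ} {ha : ContDiffOn ℝ ∞ a J}
  {hpos : ∀ t ∈ J, 0 < a t} {o : hyperquadric N l c}

theorem units_cast_mul_self (u : ℤˣ) : ((u : ℤ) : ℝ) * ((u : ℤ) : ℝ) = 1 := by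
  rcases Int.units_eq_one_or u with rfl | rfl <;> norm_num

/-- The warped product of `J` and the hyperquadric of signature `l` and curvature `c`. -/
def warpedHyperquadric (l : ℕ) (ε c : ℤˣ) (J : TopologicalSpace.Opens ℝ) (a : ℝ → ℝ)
    (ha : ContDiffOn ℝ ∞ a J) (hpos : ∀ t ∈ J, 0 < a t) : WarpedQuadric (Fin (N + 1) → ℝ) where
  ε := ((ε : ℤ) : ℝ)
  c := ((c : ℤ) : ℝ)
  form := pseudoForm N (ambientIndex l c)
  base := J
  a := a
  ε_ne_zero := unit_ne_zero ε
  c_ne_zero := unit_ne_zero c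
  form_symm := pseudoForm_comm N _
  isOpen_base := J.isOpen
  contDiffOn := ha
  ne_zero ht := (hpos _ ht).ne'

/-- The inclusion of the warped product in `ℝ × ℝ^(N+1)`. -/
def ambient (q : WarpedProduct J o) : ℝ × (Fin (N + 1) → ℝ) :=
  (time q, space q)

theorem mvfderiv_ambient (q : WarpedProduct J o) (u : TangentSpace (warpedModel N) q) :
    mvfderiv (warpedModel N) ambient q u =
      (mvfderiv (warpedModel N) time q u, mvfderiv (warpedModel N) space q u) :=
  mvfderiv_prodMk ((contMDiff_time q).mdifferentiableAt (by simp))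
    ((contMDiff_space q).mdifferentiableAt (by simp)) u

theorem isSubmersive_ambient :
    (warpedHyperquadric l ε c J a ha hpos).geometry.IsSubmersive (warpedModel N)
      (ambient (J := J) (o := o)) where
  contMDiff := contMDiff_time.prodMk_space contMDiff_space
  mem q := ⟨q.1.2, q.2.1.2⟩
  conormal_mvfderiv q u := by
    rw [mvfderiv_ambient]
    exact (pseudoForm_comm ..).trans (pseudoForm_space q u)
  exists_mvfderiv_eq q w hw := by
    obtain ⟨u, ht, hs⟩ := exists_tangent q w.1 w.2 ((pseudoForm_comm ..).trans hw)
    exact ⟨u, by rw [mvfderiv_ambient, ht, hs]⟩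

theorem induces_ambient : (warpedHyperquadric l ε c J a ha hpos).geometry.Induces
    (ambient (J := J) (o := o)) (warpedMetric ε J a ha hpos o) := by
  intro q u v
  rw [mvfderiv_ambient, mvfderiv_ambient]
  exact ((warpedHyperquadric l ε c J a ha hpos).metric_apply (ambient q) (_, _) (_, _)).symm

end warped

end SemiRiemannian

end

theorem proposition3p2_general {N l : ℕ} (ε c : ℤˣ) (o : SemiRiemannian.hyperquadric N l c)
    (J : TopologicalSpace.Opens ℝ) (a : ℝ → ℝ) (ha : ContDiffOn ℝ ∞ a J) (hpos : ∀ t ∈ J, 0 < a t)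
    {E : Type*} [NormedAddCommGroup E] [NormedSpace ℝ E] [FiniteDimensional ℝ E]
    {H : Type*} [TopologicalSpace H] {I : ModelWithCorners ℝ E H} [I.Boundaryless]
    {M : Type*} [TopologicalSpace M] [ChartedSpace H M] [IsManifold I ∞ M]
    (g : SemiRiemannian.Metric I M) (f : M → SemiRiemannian.WarpedProduct J o)
    (hf : SemiRiemannian.IsIsometricImmersion g (SemiRiemannian.warpedMetric ε J a ha hpos o) f)
    (X Y Z W : Π p : M, TangentSpace I p) (p : M)
    (hX : MDiffAt (T% X) p) (hY : MDiffAt (T% Y) p) (hZ : SemiRiemannian.IsSmoothField I Z)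
    (hW : MDiffAt (T% W) p) :
    let gbar := SemiRiemannian.warpedMetric ε J a ha hpos o
    let α := SemiRiemannian.secondFundamentalForm g gbar f
    let τ : M → ℝ := fun q ↦ SemiRiemannian.time (f q)
    let T : TangentSpace I p := ((ε : ℤ) : ℝ) • g.gradient τ p
    let s : ℝ := ((ε : ℤ) : ℝ)
    let k : ℝ := ((c : ℤ) : ℝ)
    let b : ℝ := a (τ p)
    let b' : ℝ := deriv a (τ p)
    let b'' : ℝ := deriv (deriv a) (τ p)
    g.curvatureTensor X Y Z W p =
      (s * b' ^ 2 / b ^ 2 - k / b ^ 2) *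
          (g.val p (X p) (Z p) * g.val p (Y p) (W p) - g.val p (Y p) (Z p) * g.val p (X p) (W p)) +
        (b'' / b - b' ^ 2 / b ^ 2 + s * k / b ^ 2) *
          (g.val p (X p) (Z p) * g.val p (Y p) T * g.val p (W p) T -
            g.val p (Y p) (Z p) * g.val p (X p) T * g.val p (W p) T -
            g.val p (X p) (W p) * g.val p (Y p) T * g.val p (Z p) T +
            g.val p (Y p) (W p) * g.val p (X p) T * g.val p (Z p) T) -
        gbar.val (f p) (α X Z p) (α Y W p) + gbar.val (f p) (α X W p) (α Y Z p) := by
  intro gbar α τ T s k b b' b''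
  have hT (v w : TangentSpace I p) :
      g.val p v T * g.val p w T = mvfderiv I τ p v * mvfderiv I τ p w := by
    rw [g.val_smul_gradient, g.val_smul_gradient, mul_mul_mul_comm,
      SemiRiemannian.units_cast_mul_self, one_mul]
  let D := SemiRiemannian.warpedHyperquadric (N := N) l ε c J a ha hpos
  have hε : D.ε⁻¹ = s := inv_eq_of_mul_eq_one_left (SemiRiemannian.units_cast_mul_self ε)
  have hc : D.c⁻¹ = k := inv_eq_of_mul_eq_one_left (SemiRiemannian.units_cast_mul_self c)
  have hgauss := D.curvatureTensor_eq SemiRiemannian.isSubmersive_ambient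
    SemiRiemannian.induces_ambient hf hX hY hZ hW
  rw [hε, hc] at hgauss
  rw [gbar.symm (f p) (α X W p)]
  simp only [mul_assoc, hT]
  exact hgauss

/-- The Gauss equation of a semi-Riemannian manifold that is isometrically immersed in the warped
product of an interval and a space form. -/
theorem proposition3p2 {n N l : ℕ} (hN : 2 ≤ N) (hl : l ≤ N) (ε c : ℤˣ)
    (o : SemiRiemannian.hyperquadric N l c)
    (J : TopologicalSpace.Opens ℝ) (hJ : IsConnected (J : Set ℝ))
    (a : ℝ → ℝ) (ha : ContDiffOn ℝ ∞ a J) (hpos : ∀ t ∈ J, 0 < a t)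
    {M : Type*} [TopologicalSpace M] [T2Space M] [SecondCountableTopology M] [ConnectedSpace M]
    [ChartedSpace (EuclideanSpace ℝ (Fin n)) M] [IsManifold (𝓡 n) ∞ M]
    (g : SemiRiemannian.Metric (𝓡 n) M) (f : M → SemiRiemannian.WarpedProduct J o)
    (hf : SemiRiemannian.IsIsometricImmersion g (SemiRiemannian.warpedMetric ε J a ha hpos o) f)
    (X Y Z W : Π p : M, TangentSpace (𝓡 n) p)
    (hX : SemiRiemannian.IsSmoothField (𝓡 n) X) (hY : SemiRiemannian.IsSmoothField (𝓡 n) Y)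
    (hZ : SemiRiemannian.IsSmoothField (𝓡 n) Z) (hW : SemiRiemannian.IsSmoothField (𝓡 n) W)
    (p : M) :
    let gbar := SemiRiemannian.warpedMetric ε J a ha hpos o
    let α := SemiRiemannian.secondFundamentalForm g gbar f
    let τ : M → ℝ := fun q ↦ SemiRiemannian.time (f q)
    let T : TangentSpace (𝓡 n) p := ((ε : ℤ) : ℝ) • g.gradient τ p
    let s : ℝ := ((ε : ℤ) : ℝ)
    let k : ℝ := ((c : ℤ) : ℝ)
    let b : ℝ := a (τ p)
    let b' : ℝ := deriv a (τ p)
    let b'' : ℝ := deriv (deriv a) (τ p)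
    g.curvatureTensor X Y Z W p =
      (s * b' ^ 2 / b ^ 2 - k / b ^ 2) *
          (g.val p (X p) (Z p) * g.val p (Y p) (W p) - g.val p (Y p) (Z p) * g.val p (X p) (W p)) +
        (b'' / b - b' ^ 2 / b ^ 2 + s * k / b ^ 2) *
          (g.val p (X p) (Z p) * g.val p (Y p) T * g.val p (W p) T -
            g.val p (Y p) (Z p) * g.val p (X p) T * g.val p (W p) T -
            g.val p (X p) (W p) * g.val p (Y p) T * g.val p (Z p) T +
            g.val p (Y p) (W p) * g.val p (X p) T * g.val p (Z p) T) -
        gbar.val (f p) (α X Z p) (α Y W p) + gbar.val (f p) (α X W p) (α Y Z p) :=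
  proposition3p2_general ε c o J a ha hpos g f hf X Y Z W p (hX.mdifferentiableAt p)
    (hY.mdifferentiableAt p) hZ (hW.mdifferentiableAt p)
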